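/- Let $d\ge 1$. Let $\mathbf N$ be the space of locally finite subsets of $\mathbb R^d$, with the $\sigma$-field generated by the maps $\varphi\mapsto\varphi(B):=\operatorname{card}(\varphi\cap B)$, $B\subset\mathbb R^d$ Borel. Let $\lambda_d$ be Lebesgue measure, $\|\cdot\|$ the Euclidean norm, and $B(z,r)$ the closed ball with centre $z$ and radius $r$. **Matching.** Let $\varphi,\psi\in\mathbf N$. A point $p\in\varphi$ prefers $x\in\psi$ to $y\in\psi$ if $\|x-p\|<\|y-p\|$, or if $\|x-p\|=\|y-p\|$ and $x$ is lexicographically strictly smaller than $y$. A point $x\in\psi$ prefers $p\in\varphi$ to $q\in\varphi$ if $\|p-x\|<\|q-x\|$, or if $\|p-x\|=\|q-x\|$ and $p$ is lexicographically strictly larger than $q$. Put $\varphi_0=\varphi$, $\psi_0=\psi$. In round $n+1$ match $p\in\varphi_n$ with $x\in\psi_n$ if $x$ is the lexicographically smallest nearest neighbour of $p$ in $\psi_n$ and $p$ is the lexicographically largest nearest neighbour of $x$ in $\varphi_n$; let $\varphi_{n+1},\psi_{n+1}$ be the points of $\varphi_n,\psi_n$ not matched in this round. Write $\tau(p)=x$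 and $\tau(x)=p$ if $p$ and $x$ are matched in some round, and $\tau(z)=\infty$ for the points $z\in\varphi\cup\psi$ that are never matched. **Matching flower.** A descending chain in $(\varphi,\psi)$ is a sequence $(z_1,\dots,z_n)$, $n\ge2$, with $z_i\in\varphi$ for odd $i$, $z_i\in\psi$ for even $i$, such that $z_i$ prefers $z_{i+1}$ to $z_{i-1}$ for $2\le i\le n-1$. For $p\in\varphi$ let $F(\varphi,\psi,p)=\mathbb R^d$ if $\tau(p)=\infty$. Otherwise let $$F(\varphi,\psi,p)=\bigcup_{(z_1,\dots,z_n)}\Big(B(z_1,\|z_1-z_2\|)\cup\bigcup_{i=2}^nB(z_i,\|z_i-z_{i-1}\|)\Big),$$ where the union is over all descending chains $(z_1,\dots,z_n)$, $n\geq 2$, in $(\varphi,\psi)$ with $z_1=p$ such that $z_2$ equals $\tau(p)$ or is preferred by $p$ to $\tau(p)$. **Point processes.** Let $\Psi$ be a stationary (simple) point process on $\mathbb R^d$, that is, a random element of $\mathbf N$ such that $\Psi+x$ has the same distribution as $\Psi$ for every $x\in\mathbb R^d$. Its intensity is $\mathbb E[\Psi([0,1]^d)]$. For $p,q,s\ge0$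 let $$\alpha_{p,q}(s)=\sup|\operatorname{Cov}(f(\Psi\cap A),g(\Psi\cap B))|,$$ where the supremum is over all measurable $f,g:\mathbf N\to\{0,1\}$ and all Borel sets $A,B\subset\mathbb R^d$ with $\lambda_d(A)\le p$, $\lambda_d(B)\le q$ and $\inf_{x\in A,y\in B}\|x-y\|\ge s$ (where $\inf\emptyset=\infty$). Put $F(0)=F(\mathbb Z^d,\Psi,0)$ and let $\Psi^\tau_0$ be the set of those points of $\Psi$ that are matched when $\tau$ is formed from $(\varphi,\psi)=(\mathbb Z^d,\Psi)$. **Theorem.** Let $\Psi$ be a stationary point process with finite intensity $\alpha\ge1$. Assume that for some $\gamma\in(0,1]$ $$\sum_{w\in\mathbb Z^d}\|w\|^{\gamma d}\,\alpha_{\|w\|^{\gamma d},\|w\|^{\gamma d}}(\|w\|)<\infty\quad\text{and}\quad\sum_{w\in\mathbb Z^d}\mathbb P\big(F(0)\not\subset B(0,\|w\|^\gamma)\big)<\infty.$$ Then $\Psi^\tau_0$ is hyperuniform: for every convex compact set $W\subset\mathbb R^d$ with $\lambda_d(W)>0$, the random variable $\Psi^\tau_0(rW)$ is square-integrable for every $r>0$,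 and $$\lim_{r\to\infty}\frac{\operatorname{Var}\big(\Psi^\tau_0(rW)\big)}{\lambda_d(rW)}=0.$$ -/

import Mathlib

open MeasureTheory ProbabilityTheory Filter Topology
open scoped ENNReal Pointwise

namespace StableMatching

/-- The space `ℝ^d` with its Euclidean norm. -/
abbrev Space (d : ℕ) : Type := EuclideanSpace ℝ (Fin d)

/-- Locally finite subsets of `ℝ^d`. -/
structure Config (d : ℕ) where
  carrier : Set (Space d)
  locallyFinite : ∀ B : Set (Space d), Bornology.IsBounded B → (carrier ∩ B).Finite

namespace Config

variable {d : ℕ}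

/-- The number `φ(B)` of points of `φ` in `B`, possibly infinite. -/
noncomputable def count (φ : Config d) (B : Set (Space d)) : ℕ∞ := (φ.carrier ∩ B).encard

/-- The σ-field on the space of locally finite sets generated by the maps `φ ↦ φ(B)`,
`B` a Borel set. -/
noncomputable instance : MeasurableSpace (Config d) :=
  ⨆ (B : Set (Space d)) (_ : MeasurableSet B),
    MeasurableSpace.comap (fun φ : Config d => φ.count B) ⊤

/-- The restriction `φ ∩ A`. -/
def restrict (φ : Config d) (A : Set (Space d)) : Config d where
  carrier := φ.carrier ∩ A
  locallyFinite B hB :=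
    (φ.locallyFinite B hB).subset (Set.inter_subset_inter_left B Set.inter_subset_left)

/-- The translate `φ + x`. -/
def shift (φ : Config d) (x : Space d) : Config d where
  carrier := (fun y => y + x) '' φ.carrier
  locallyFinite B hB := by
    have hb : Bornology.IsBounded ((fun y => y + (-x)) '' B) := by
      rw [Set.image_add_right]
      obtain ⟨R, hR⟩ := hB.subset_closedBall 0
      refine (Metric.isBounded_closedBall (x := (0 : Space d)) (r := R + ‖x‖)).subset ?_
      intro y hy
      have h1 := hR hy
      simp only [neg_neg, mem_closedBall_zero_iff] at h1 ⊢
      have h2 := norm_sub_le (y + x) x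
      rw [add_sub_cancel_right] at h2
      linarith
    refine ((φ.locallyFinite _ hb).image (fun y => y + x)).subset ?_
    rintro _ ⟨⟨y, hy, rfl⟩, hyB⟩
    exact ⟨y, ⟨hy, y + x, hyB, by simp⟩, rfl⟩

end Config

/-- The point of `ℝ^d` with the given integer coordinates. -/
noncomputable def latticePoint {d : ℕ} (w : Fin d → ℤ) : Space d :=
  WithLp.toLp 2 (fun i => (w i : ℝ))

/-- The lattice `ℤ^d`. -/
noncomputable def lattice (d : ℕ) : Config d where
  carrier := Set.range latticePoint
  locallyFinite B hB := by
    obtain ⟨R, hR⟩ := hB.subset_closedBall 0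
    refine ((Set.finite_Icc (fun _ : Fin d => -⌈R⌉) (fun _ => ⌈R⌉)).image latticePoint).subset ?_
    rintro _ ⟨⟨w, rfl⟩, hw⟩
    have hn : ‖latticePoint w‖ ≤ R := by simpa using hR hw
    have hi : ∀ i, |(w i : ℝ)| ≤ (⌈R⌉ : ℝ) := fun i => by
      have h1 := PiLp.norm_apply_le (latticePoint w) i
      have h2 : ‖(latticePoint w) i‖ = |(w i : ℝ)| := rfl
      rw [h2] at h1
      exact (h1.trans hn).trans (Int.le_ceil R)
    refine ⟨w, ⟨fun i => ?_, fun i => ?_⟩, rfl⟩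
    · have := (abs_le.mp (hi i)).1
      exact_mod_cast this
    · have := (abs_le.mp (hi i)).2
      exact_mod_cast this

section Matching

variable {d : ℕ}

/-- `x` is lexicographically strictly smaller than `y`. -/
def LexLT (x y : Space d) : Prop := toLex (WithLp.ofLp x) < toLex (WithLp.ofLp y)

/-- `p` is a nearest neighbour of `x` in `φ`. -/
def IsNearest (φ : Set (Space d)) (x p : Space d) : Prop :=
  p ∈ φ ∧ ∀ q ∈ φ, dist x p ≤ dist x q

/-- `N⁻(φ, x) = p`: `p` is the lexicographically smallest nearest neighbour of `x` in `φ`. -/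
def IsNearestMin (φ : Set (Space d)) (x p : Space d) : Prop :=
  IsNearest φ x p ∧ ∀ q, IsNearest φ x q → ¬ LexLT q p

/-- `N⁺(φ, x) = p`: `p` is the lexicographically largest nearest neighbour of `x` in `φ`. -/
def IsNearestMax (φ : Set (Space d)) (x p : Space d) : Prop :=
  IsNearest φ x p ∧ ∀ q, IsNearest φ x q → ¬ LexLT p q

/-- `p ∈ φ` and `x ∈ ψ` are mutual nearest neighbours: `N⁻(ψ, p) = x` and `N⁺(φ, x) = p`. -/
def MutualNearest (φ ψ : Set (Space d)) (p x : Space d) : Prop :=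
  IsNearestMin ψ p x ∧ IsNearestMax φ x p

/-- The points `(φ_n, ψ_n)` still unmatched after `n` rounds of mutual nearest neighbour
matching: in each round all mutual nearest neighbours are matched and removed. -/
def remaining (φ ψ : Set (Space d)) : ℕ → Set (Space d) × Set (Space d)
  | 0 => (φ, ψ)
  | n + 1 =>
    ({p ∈ (remaining φ ψ n).1 |
        ¬ ∃ x, MutualNearest (remaining φ ψ n).1 (remaining φ ψ n).2 p x},
      {x ∈ (remaining φ ψ n).2 |
        ¬ ∃ p, MutualNearest (remaining φ ψ n).1 (remaining φ ψ n).2 p x})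

/-- `τ(φ, ψ, p) = x` (equivalently `τ(φ, ψ, x) = p`) for `p ∈ φ`, `x ∈ ψ`, where `τ` is the mutual
nearest neighbour matching: `p` and `x` are matched to each other in some round. A point without
partner in this relation is one that `τ` sends to `∞`. -/
def Matched (φ ψ : Set (Space d)) (p x : Space d) : Prop :=
  ∃ n, MutualNearest (remaining φ ψ n).1 (remaining φ ψ n).2 p x

/-- The set of matched points of `ψ`, i.e. of those `x ∈ ψ` with `τ(φ, ψ, x) ≠ ∞`. -/
def matchedPoints (φ ψ : Config d) : Config d where
  carrier := {x ∈ ψ.carrier | ∃ p, Matched φ.carrier ψ.carrier p x}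
  locallyFinite B hB :=
    (ψ.locallyFinite B hB).subset (Set.inter_subset_inter_left B (Set.sep_subset _ _))

/-- The point `p` of the first set prefers `x` to `y` (points of the second set). -/
def FirstPrefers (p x y : Space d) : Prop :=
  dist x p < dist y p ∨ (dist x p = dist y p ∧ LexLT x y)

/-- The point `x` of the second set prefers `p` to `q` (points of the first set). -/
def SecondPrefers (x p q : Space d) : Prop :=
  dist p x < dist q x ∨ (dist p x = dist q x ∧ LexLT q p)

/-- `(z 1, …, z n)` is a descending chain in `(φ, ψ)`; the other values of `z` are irrelevant. -/
structure IsDescendingChain (φ ψ : Set (Space d)) (n : ℕ) (z : ℕ → Space d) : Prop where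
  two_le : 2 ≤ n
  mem_first : ∀ i, 1 ≤ i → i ≤ n → Odd i → z i ∈ φ
  mem_second : ∀ i, 1 ≤ i → i ≤ n → Even i → z i ∈ ψ
  prefers_first : ∀ i, 1 ≤ i → i + 2 ≤ n → Odd (i + 1) → FirstPrefers (z (i + 1)) (z (i + 2)) (z i)
  prefers_second : ∀ i, 1 ≤ i → i + 2 ≤ n → Even (i + 1) →
    SecondPrefers (z (i + 1)) (z (i + 2)) (z i)

/-- `(z 1, …, z n)` is a competing chain in `(φ, ψ)` for the matched point `p ∈ φ`: a descending
chain with `z 1 = p` for which `z 2` is equal to, or preferred by `p` to, the partner of `p`. -/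
def IsCompetingChain (φ ψ : Set (Space d)) (p : Space d) (n : ℕ) (z : ℕ → Space d) : Prop :=
  IsDescendingChain φ ψ n z ∧ z 1 = p ∧
    ∃ x, Matched φ ψ p x ∧ (z 2 = x ∨ FirstPrefers p (z 2) x)

/-- The union `F_c` of balls attached to the chain `c = (z 1, …, z n)`. -/
def chainRegion (n : ℕ) (z : ℕ → Space d) : Set (Space d) :=
  Metric.closedBall (z 1) (dist (z 1) (z 2)) ∪
    ⋃ i ∈ Set.Icc 2 n, Metric.closedBall (z i) (dist (z i) (z (i - 1)))

open Classical in
/-- The matching flower `F(φ, ψ, p)` of a point `p ∈ φ`: the whole space if `p` is unmatched, and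
otherwise the union of the regions `F_c` over all competing chains `c` for `p`. -/
noncomputable def flower (φ ψ : Config d) (p : Space d) : Set (Space d) :=
  if ∃ x, Matched φ.carrier ψ.carrier p x then
    {y | ∃ n z, IsCompetingChain φ.carrier ψ.carrier p n z ∧ y ∈ chainRegion n z}
  else Set.univ

end Matching

section PointProcess

variable {d : ℕ} {Ω : Type*} [MeasurableSpace Ω]

/-- The point process `Ψ` is stationary: `Ψ + x` and `Ψ` have the same distribution for all `x`. -/
def IsStationary (Ψ : Ω → Config d) (P : Measure Ω) : Prop :=
  ∀ x : Space d, IdentDistrib (fun ω => (Ψ ω).shift x) Ψ P P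

/-- The intensity of a stationary point process, the mean number of points in `[0,1]^d`. -/
noncomputable def intensity (Ψ : Ω → Config d) (P : Measure Ω) : ℝ≥0∞ :=
  ∫⁻ ω, (((Ψ ω).count {x | ∀ i, x i ∈ Set.Icc (0 : ℝ) 1} : ℕ∞) : ℝ≥0∞) ∂P

/-- The mixing coefficient `α_{p,q}(s)` of the point process `Ψ`: the supremum of
`|Cov(f(Ψ ∩ A), g(Ψ ∩ B))|` over measurable `{0,1}`-valued `f`, `g` and Borel sets `A`, `B` with
`λ(A) ≤ p`, `λ(B) ≤ q` and `d(A, B) ≥ s`. -/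
noncomputable def mixingCoeff (Ψ : Ω → Config d) (P : Measure Ω) (p q s : ℝ) : ℝ :=
  sSup {c : ℝ | ∃ (f g : Config d → ℝ) (A B : Set (Space d)),
    Measurable f ∧ Measurable g ∧ (∀ φ, f φ = 0 ∨ f φ = 1) ∧ (∀ φ, g φ = 0 ∨ g φ = 1) ∧
    MeasurableSet A ∧ MeasurableSet B ∧
    volume A ≤ ENNReal.ofReal p ∧ volume B ≤ ENNReal.ofReal q ∧
    (∀ x ∈ A, ∀ y ∈ B, s ≤ dist x y) ∧
    c = |cov[fun ω => f ((Ψ ω).restrict A), fun ω => g ((Ψ ω).restrict B); P]|}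

/-- Hyperuniformity: for every convex compact `W` of positive volume, the number of points in `rW`
has a finite variance, which is `o(λ(rW))` as `r → ∞`. -/
def IsHyperuniform (Ψ : Ω → Config d) (P : Measure Ω) : Prop :=
  ∀ W : Set (Space d), Convex ℝ W → IsCompact W → 0 < volume W →
    (∀ r : ℝ, 0 < r → MemLp (fun ω => (((Ψ ω).count (r • W)).toNat : ℝ)) 2 P) ∧
    Tendsto (fun r : ℝ =>
      Var[fun ω => (((Ψ ω).count (r • W)).toNat : ℝ); P] / (volume (r • W)).toReal)
      atTop (𝓝 0)

end PointProcess

end StableMatching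

open StableMatching

/-! Each matched point of `Ψ` has exactly one lattice partner, so the number of matched points in
`A` is the sum over lattice points `p` of the indicator that the partner of `p` lies in `A`
(`hasSum_indicator_hitEvent`). Its variance is at most the sum of `covSum μ A w` over lattice
vectors `w`, where `covSum` collects the absolute covariances of all pairs with difference `w`. With
`A = r • W`, divided by `r ^ d`, this sum over `w` tends to zero by dominated convergence. Two
independent estimates are needed.

Termwise limit (`covSum_le_frontier`, `tendsto_covSum_smul_div`): a covariance of events is at most
the probability of either event and of its complement. A lattice point deep inside `r • W`, or far
outside, has an almost deterministic indicator, because partners are rarely far away. Lattice points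
near the boundary are negligible, since the boundary of a convex set has volume zero.

Domination (`exists_summable_bound_covSum`): the partner of `p` is determined by the points of `Ψ`
in any set containing the flower of `p` (`Matched.restrict_of_flower_subset`). Replace the partner
by the one computed from a ball of radius `ρ` around `p`. The replaced events for `p` and `p + w`
depend on distant balls and are controlled by mixing. About `(L + ρ) ^ d` lattice points contribute,
which accounts for the weight `‖w‖ ^ (γ * d)` in the mixing condition. The replacement error is
bounded by the flower tail through mass transport (`IsTransport.tsum_measure_hitEvent_le`): the
expected number of lattice points sent wrongly into a unit cell is at most the probability that the
origin is sent wrongly. -/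

namespace StableMatching

/-! ### Preferences as strict total orders -/

section Preferences

variable {d : ℕ} {p q s x y z v : Space d} {φ ψ : Set (Space d)}

theorem LexLT.irrefl (x : Space d) : ¬ LexLT x x := lt_irrefl _

theorem LexLT.trans (h₁ : LexLT x y) (h₂ : LexLT y z) : LexLT x z := lt_trans h₁ h₂

theorem lexLT_trichotomy (x y : Space d) : LexLT x y ∨ x = y ∨ LexLT y x := by
  rcases lt_trichotomy (toLex (WithLp.ofLp x)) (toLex (WithLp.ofLp y)) with h | h | h
  · exact Or.inl h
  · exact Or.inr (Or.inl (WithLp.ofLp_injective 2 (toLex.injective h)))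
  · exact Or.inr (Or.inr h)

theorem FirstPrefers.irrefl (p x : Space d) : ¬ FirstPrefers p x x := by
  rintro (h | ⟨-, h⟩)
  · exact lt_irrefl _ h
  · exact LexLT.irrefl _ h

theorem SecondPrefers.irrefl (x p : Space d) : ¬ SecondPrefers x p p := by
  rintro (h | ⟨-, h⟩)
  · exact lt_irrefl _ h
  · exact LexLT.irrefl _ h

theorem FirstPrefers.trans (h₁ : FirstPrefers p x y) (h₂ : FirstPrefers p y z) :
    FirstPrefers p x z := by
  rcases h₁ with h₁ | ⟨h₁, h₁'⟩ <;> rcases h₂ with h₂ | ⟨h₂, h₂'⟩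
  · exact Or.inl (h₁.trans h₂)
  · exact Or.inl (h₂ ▸ h₁)
  · exact Or.inl (h₁ ▸ h₂)
  · exact Or.inr ⟨h₁.trans h₂, h₁'.trans h₂'⟩

theorem SecondPrefers.trans (h₁ : SecondPrefers x p q) (h₂ : SecondPrefers x q s) :
    SecondPrefers x p s := by
  rcases h₁ with h₁ | ⟨h₁, h₁'⟩ <;> rcases h₂ with h₂ | ⟨h₂, h₂'⟩
  · exact Or.inl (h₁.trans h₂)
  · exact Or.inl (h₂ ▸ h₁)
  · exact Or.inl (h₁ ▸ h₂)
  · exact Or.inr ⟨h₁.trans h₂, h₂'.trans h₁'⟩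

theorem firstPrefers_trichotomy (p x y : Space d) :
    FirstPrefers p x y ∨ x = y ∨ FirstPrefers p y x := by
  rcases lt_trichotomy (dist x p) (dist y p) with h | h | h
  · exact Or.inl (Or.inl h)
  · rcases lexLT_trichotomy x y with h' | h' | h'
    · exact Or.inl (Or.inr ⟨h, h'⟩)
    · exact Or.inr (Or.inl h')
    · exact Or.inr (Or.inr (Or.inr ⟨h.symm, h'⟩))
  · exact Or.inr (Or.inr (Or.inl h))

theorem secondPrefers_trichotomy (x p q : Space d) :
    SecondPrefers x p q ∨ p = q ∨ SecondPrefers x q p := by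
  rcases lt_trichotomy (dist p x) (dist q x) with h | h | h
  · exact Or.inl (Or.inl h)
  · rcases lexLT_trichotomy p q with h' | h' | h'
    · exact Or.inr (Or.inr (Or.inr ⟨h.symm, h'⟩))
    · exact Or.inr (Or.inl h')
    · exact Or.inl (Or.inr ⟨h, h'⟩)
  · exact Or.inr (Or.inr (Or.inl h))

theorem FirstPrefers.dist_le (h : FirstPrefers p x y) : dist x p ≤ dist y p :=
  h.elim le_of_lt fun h => h.1.le

theorem SecondPrefers.dist_le (h : SecondPrefers x p q) : dist p x ≤ dist q x :=
  h.elim le_of_lt fun h => h.1.le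

/-- Nearest neighbour with tie-breaking is the same as being the favourite in the preference order;
from here on the rounds are treated by order arguments, without distances. -/
theorem isNearestMin_iff :
    IsNearestMin ψ p x ↔ x ∈ ψ ∧ ∀ y ∈ ψ, ¬ FirstPrefers p y x := by
  constructor
  · rintro ⟨⟨hx, hmin⟩, hlex⟩
    refine ⟨hx, fun y hy h => ?_⟩
    rcases h with h | ⟨h, h'⟩
    · have := hmin y hy
      rw [dist_comm p x, dist_comm p y] at this
      exact absurd h this.not_gt
    · refine hlex y ⟨hy, fun q hq => ?_⟩ h'
      rw [dist_comm p y, h, dist_comm x p]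
      exact hmin q hq
  · rintro ⟨hx, h⟩
    refine ⟨⟨hx, fun y hy => ?_⟩, fun y hy hlex => h y hy.1 (Or.inr ⟨?_, hlex⟩)⟩
    · by_contra hlt
      rw [not_le, dist_comm p x, dist_comm p y] at hlt
      exact h y hy (Or.inl hlt)
    · have h1 := hy.2 x hx
      rw [dist_comm p x, dist_comm p y] at h1
      exact le_antisymm h1 (not_lt.mp fun h2 => h y hy.1 (Or.inl h2))

theorem isNearestMax_iff :
    IsNearestMax φ x p ↔ p ∈ φ ∧ ∀ q ∈ φ, ¬ SecondPrefers x q p := by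
  constructor
  · rintro ⟨⟨hx, hmin⟩, hlex⟩
    refine ⟨hx, fun y hy h => ?_⟩
    rcases h with h | ⟨h, h'⟩
    · have := hmin y hy
      rw [dist_comm x p, dist_comm x y] at this
      exact absurd h this.not_gt
    · refine hlex y ⟨hy, fun q hq => ?_⟩ h'
      rw [dist_comm x y, h, dist_comm p x]
      exact hmin q hq
  · rintro ⟨hx, h⟩
    refine ⟨⟨hx, fun y hy => ?_⟩, fun y hy hlex => h y hy.1 (Or.inr ⟨?_, hlex⟩)⟩
    · by_contra hlt
      rw [not_le, dist_comm x p, dist_comm x y] at hlt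
      exact h y hy (Or.inl hlt)
    · have h1 := hy.2 p hx
      rw [dist_comm x p, dist_comm x y] at h1
      exact le_antisymm h1 (not_lt.mp fun h2 => h y hy.1 (Or.inl h2))

end Preferences

/-! ### The rounds of the matching and its stability -/

section Rounds

variable {d : ℕ} {p q x y : Space d} {φ ψ : Set (Space d)} {m n : ℕ}

theorem remaining_fst_antitone (φ ψ : Set (Space d)) :
    Antitone fun n => (remaining φ ψ n).1 :=
  antitone_nat_of_succ_le fun _ => Set.sep_subset _ _

theorem remaining_snd_antitone (φ ψ : Set (Space d)) :
    Antitone fun n => (remaining φ ψ n).2 :=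
  antitone_nat_of_succ_le fun _ => Set.sep_subset _ _

/-- `p` and `x` are matched to each other in round `n + 1`. -/
def MatchedAt (φ ψ : Set (Space d)) (n : ℕ) (p x : Space d) : Prop :=
  MutualNearest (remaining φ ψ n).1 (remaining φ ψ n).2 p x

theorem matchedAt_iff : MatchedAt φ ψ n p x ↔
    (x ∈ (remaining φ ψ n).2 ∧ ∀ y ∈ (remaining φ ψ n).2, ¬ FirstPrefers p y x) ∧
      (p ∈ (remaining φ ψ n).1 ∧ ∀ q ∈ (remaining φ ψ n).1, ¬ SecondPrefers x q p) := by
  rw [MatchedAt, MutualNearest, isNearestMin_iff, isNearestMax_iff]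

theorem mem_remaining_fst_iff :
    p ∈ (remaining φ ψ n).1 ↔ p ∈ φ ∧ ∀ m < n, ∀ x, ¬ MatchedAt φ ψ m p x := by
  induction n with
  | zero => simp [remaining]
  | succ n ih =>
    change (p ∈ (remaining φ ψ n).1 ∧ ¬ ∃ x, MatchedAt φ ψ n p x) ↔ _
    rw [ih, and_assoc, not_exists]
    refine and_congr_right fun _ => ?_
    simp only [Nat.lt_succ_iff_lt_or_eq, or_imp, forall_and, forall_eq]

theorem mem_remaining_snd_iff :
    x ∈ (remaining φ ψ n).2 ↔ x ∈ ψ ∧ ∀ m < n, ∀ p, ¬ MatchedAt φ ψ m p x := by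
  induction n with
  | zero => simp [remaining]
  | succ n ih =>
    change (x ∈ (remaining φ ψ n).2 ∧ ¬ ∃ p, MatchedAt φ ψ n p x) ↔ _
    rw [ih, and_assoc, not_exists]
    refine and_congr_right fun _ => ?_
    simp only [Nat.lt_succ_iff_lt_or_eq, or_imp, forall_and, forall_eq]

theorem MatchedAt.fst_mem (h : MatchedAt φ ψ n p x) : p ∈ (remaining φ ψ n).1 :=
  (matchedAt_iff.mp h).2.1

theorem MatchedAt.snd_mem (h : MatchedAt φ ψ n p x) : x ∈ (remaining φ ψ n).2 :=
  (matchedAt_iff.mp h).1.1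

theorem Matched.fst_mem (h : Matched φ ψ p x) : p ∈ φ := by
  obtain ⟨n, hn⟩ := h
  exact (mem_remaining_fst_iff.mp (MatchedAt.fst_mem hn)).1

theorem Matched.snd_mem (h : Matched φ ψ p x) : x ∈ ψ := by
  obtain ⟨n, hn⟩ := h
  exact (mem_remaining_snd_iff.mp (MatchedAt.snd_mem hn)).1

theorem MatchedAt.round_le_of_fst (h : MatchedAt φ ψ m p x) (h' : MatchedAt φ ψ n p y) :
    n ≤ m := by
  by_contra! hlt
  exact (mem_remaining_fst_iff.mp h'.fst_mem).2 m hlt x h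

theorem MatchedAt.round_le_of_snd (h : MatchedAt φ ψ m p x) (h' : MatchedAt φ ψ n q x) :
    n ≤ m := by
  by_contra! hlt
  exact (mem_remaining_snd_iff.mp h'.snd_mem).2 m hlt p h

theorem Matched.snd_unique (h : Matched φ ψ p x) (h' : Matched φ ψ p y) : x = y := by
  obtain ⟨m, hm⟩ := h
  obtain ⟨n, hn⟩ := h'
  obtain rfl : m = n := le_antisymm (MatchedAt.round_le_of_fst hn hm)
    (MatchedAt.round_le_of_fst hm hn)
  rw [← MatchedAt, matchedAt_iff] at hm hn
  rcases firstPrefers_trichotomy p x y with h | h | h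
  · exact absurd h (hn.1.2 x hm.1.1)
  · exact h
  · exact absurd h (hm.1.2 y hn.1.1)

theorem Matched.fst_unique (h : Matched φ ψ p x) (h' : Matched φ ψ q x) : p = q := by
  obtain ⟨m, hm⟩ := h
  obtain ⟨n, hn⟩ := h'
  obtain rfl : m = n := le_antisymm (MatchedAt.round_le_of_snd hn hm)
    (MatchedAt.round_le_of_snd hm hn)
  rw [← MatchedAt, matchedAt_iff] at hm hn
  rcases secondPrefers_trichotomy x p q with h | h | h
  · exact absurd h (hn.2.2 p hm.2.1)
  · exact h
  · exact absurd h (hm.2.2 q hn.2.1)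

/-- A point that `p` prefers to its partner is matched in an earlier round, to a point that it
prefers to `p`. -/
theorem MatchedAt.exists_of_firstPrefers (h : MatchedAt φ ψ n p x) (hy : y ∈ ψ)
    (hp : FirstPrefers p y x) :
    ∃ m < n, ∃ q, MatchedAt φ ψ m q y ∧ SecondPrefers y q p := by
  have hnot : y ∉ (remaining φ ψ n).2 := fun h' => (matchedAt_iff.mp h).1.2 y h' hp
  rw [mem_remaining_snd_iff] at hnot
  push Not at hnot
  obtain ⟨m, hm, q, hq⟩ := hnot hy
  refine ⟨m, hm, q, hq, ?_⟩
  rcases secondPrefers_trichotomy y q p with h' | rfl | h'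
  · exact h'
  · exact absurd (hq.round_le_of_fst h) hm.not_ge
  · exact absurd h' ((matchedAt_iff.mp hq).2.2 p (remaining_fst_antitone φ ψ hm.le h.fst_mem))

/-- A point that `x` prefers to its partner is matched in an earlier round, to a point that it
prefers to `x`. -/
theorem MatchedAt.exists_of_secondPrefers (h : MatchedAt φ ψ n p x) (hq : q ∈ φ)
    (hx : SecondPrefers x q p) :
    ∃ m < n, ∃ y, MatchedAt φ ψ m q y ∧ FirstPrefers q y x := by
  have hnot : q ∉ (remaining φ ψ n).1 := fun h' => (matchedAt_iff.mp h).2.2 q h' hx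
  rw [mem_remaining_fst_iff] at hnot
  push Not at hnot
  obtain ⟨m, hm, y, hy⟩ := hnot hq
  refine ⟨m, hm, y, hy, ?_⟩
  rcases firstPrefers_trichotomy q y x with h' | rfl | h'
  · exact h'
  · exact absurd (hy.round_le_of_snd h) hm.not_ge
  · exact absurd h' ((matchedAt_iff.mp hy).1.2 x (remaining_snd_antitone φ ψ hm.le h.snd_mem))

/-- If all points preferred by `p` to `x` and all points preferred by `x` to `p` are matched to
better partners, then `p` and `x` are matched. -/
theorem matched_of_forall_better {φ ψ : Config d} (hp : p ∈ φ.carrier) (hx : x ∈ ψ.carrier)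
    (hfst : ∀ y ∈ ψ.carrier, FirstPrefers p y x →
      ∃ q, Matched φ.carrier ψ.carrier q y ∧ SecondPrefers y q p)
    (hsnd : ∀ q ∈ φ.carrier, SecondPrefers x q p →
      ∃ y, Matched φ.carrier ψ.carrier q y ∧ FirstPrefers q y x) :
    Matched φ.carrier ψ.carrier p x := by
  by_contra hcon
  have hp_not : ∀ y, FirstPrefers p y x → ¬ Matched φ.carrier ψ.carrier p y := fun y hy hm => by
    obtain ⟨q, hq, hqp⟩ := hfst y hm.snd_mem hy
    exact SecondPrefers.irrefl y p (hq.fst_unique hm ▸ hqp)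
  have hx_not : ∀ q, SecondPrefers x q p → ¬ Matched φ.carrier ψ.carrier q x := fun q hq hm => by
    obtain ⟨y, hy, hyx⟩ := hsnd q hm.fst_mem hq
    exact FirstPrefers.irrefl q x (hy.snd_unique hm ▸ hyx)
  have hnever : ∀ n, p ∈ (remaining φ.carrier ψ.carrier n).1 ∧
      x ∈ (remaining φ.carrier ψ.carrier n).2 := by
    intro n
    induction n with
    | zero => exact ⟨hp, hx⟩
    | succ n ih =>
      refine ⟨⟨ih.1, ?_⟩, ⟨ih.2, ?_⟩⟩
      · rintro ⟨y, hy⟩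
        change MatchedAt φ.carrier ψ.carrier n p y at hy
        rcases firstPrefers_trichotomy p y x with h | rfl | h
        · exact hp_not y h ⟨n, hy⟩
        · exact hcon ⟨n, hy⟩
        · exact (matchedAt_iff.mp hy).1.2 x ih.2 h
      · rintro ⟨q, hq⟩
        change MatchedAt φ.carrier ψ.carrier n q x at hq
        rcases secondPrefers_trichotomy x q p with h | rfl | h
        · exact hx_not q h ⟨n, hq⟩
        · exact hcon ⟨n, hq⟩
        · exact (matchedAt_iff.mp hq).2.2 p ih.1 h
  -- By local finiteness only finitely many points are better for `p` than `x`, and all of them are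
  -- eventually removed; likewise for `x`. If both `p` and `x` survived forever, they would then be
  -- each other's favourites and be matched.
  have hev₁ : ∀ᶠ n in atTop, ∀ y ∈ ψ.carrier ∩ Metric.closedBall p (dist x p),
      FirstPrefers p y x → y ∉ (remaining φ.carrier ψ.carrier n).2 := by
    rw [(ψ.locallyFinite _ Metric.isBounded_closedBall).eventually_all]
    intro y hy
    by_cases h : FirstPrefers p y x
    · obtain ⟨q, ⟨m, hm⟩, -⟩ := hfst y hy.1 h
      filter_upwards [eventually_gt_atTop m] with n hn _ hmem
      exact (mem_remaining_snd_iff.mp hmem).2 m hn q hm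
    · exact Eventually.of_forall fun n h' => absurd h' h
  have hev₂ : ∀ᶠ n in atTop, ∀ q ∈ φ.carrier ∩ Metric.closedBall x (dist p x),
      SecondPrefers x q p → q ∉ (remaining φ.carrier ψ.carrier n).1 := by
    rw [(φ.locallyFinite _ Metric.isBounded_closedBall).eventually_all]
    intro q hq
    by_cases h : SecondPrefers x q p
    · obtain ⟨y, ⟨m, hm⟩, -⟩ := hsnd q hq.1 h
      filter_upwards [eventually_gt_atTop m] with n hn _ hmem
      exact (mem_remaining_fst_iff.mp hmem).2 m hn y hm
    · exact Eventually.of_forall fun n h' => absurd h' h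
  obtain ⟨n, h₁, h₂⟩ := (hev₁.and hev₂).exists
  refine hcon ⟨n, matchedAt_iff.mpr ⟨⟨(hnever n).2, fun y hy h => ?_⟩, (hnever n).1,
    fun q hq h => ?_⟩⟩
  · exact h₁ y ⟨(mem_remaining_snd_iff.mp hy).1, h.dist_le⟩ h hy
  · exact h₂ q ⟨(mem_remaining_fst_iff.mp hq).1, h.dist_le⟩ h hq

end Rounds

/-! ### The flower determines the partner -/

section Locality

variable {d : ℕ} {p q x y : Space d}

/-- The sequence `(p, y, z 1, z 2, …)`. -/
def prependTwo (p y : Space d) (z : ℕ → Space d) : ℕ → Space d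
  | 0 => p
  | 1 => p
  | 2 => y
  | i + 3 => z (i + 1)

theorem IsDescendingChain.prependTwo {φ ψ : Set (Space d)} {n : ℕ} {z : ℕ → Space d}
    (h : IsDescendingChain φ ψ n z) (hp : p ∈ φ) (hy : y ∈ ψ)
    (hyp : SecondPrefers y (z 1) p) (hzy : FirstPrefers (z 1) (z 2) y) :
    IsDescendingChain φ ψ (n + 2) (prependTwo p y z) where
  two_le := by lia
  mem_first i hi hin ho := by
    match i, hi, ho with
    | 1, _, _ => exact hp
    | 2, _, ho => exact absurd ho (by decide)
    | i + 3, _, ho => exact h.mem_first (i + 1) (by lia) (by lia) (by grind)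
  mem_second i hi hin he := by
    match i, hi, he with
    | 1, _, he => exact absurd he (by decide)
    | 2, _, _ => exact hy
    | i + 3, _, he => exact h.mem_second (i + 1) (by lia) (by lia) (by grind)
  prefers_first i hi hin ho := by
    match i, hi, ho with
    | 1, _, ho => exact absurd ho (by decide)
    | 2, _, _ => exact hzy
    | i + 3, _, ho => exact h.prefers_first (i + 1) (by lia) (by lia) (by grind)
  prefers_second i hi hin he := by
    match i, hi, he with
    | 1, _, _ => exact hyp
    | 2, _, he => exact absurd he (by decide)
    | i + 3, _, he => exact h.prefers_second (i + 1) (by lia) (by lia) (by grind)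

/-- Replacing the start by a point that `z 2` likes less only weakens the one condition involving
the start. -/
theorem IsDescendingChain.update_first {φ ψ : Set (Space d)} {n : ℕ} {z : ℕ → Space d}
    (h : IsDescendingChain φ ψ n z) (hp : p ∈ φ) (hzp : SecondPrefers (z 2) (z 1) p) :
    IsDescendingChain φ ψ n (Function.update z 1 p) where
  two_le := h.two_le
  mem_first i hi hin ho := by
    by_cases h1 : i = 1
    · simpa [h1] using hp
    · simpa [h1] using h.mem_first i hi hin ho
  mem_second i hi hin he := by
    have h1 : i ≠ 1 := by rintro rfl; exact absurd he (by decide)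
    simpa [h1] using h.mem_second i hi hin he
  prefers_first i hi hin ho := by
    have h1 : i ≠ 1 := by rintro rfl; exact absurd ho (by decide)
    have h0 : i ≠ 0 := by lia
    simpa [h1, h0] using h.prefers_first i hi hin ho
  prefers_second i hi hin he := by
    have h0 : i ≠ 0 := by lia
    by_cases h1 : i = 1
    · subst h1
      simpa using (h.prefers_second 1 hi hin he).trans hzp
    · simpa [h1, h0] using h.prefers_second i hi hin he

/-- If all points of `ψ` on descending chains that start in `p` and continue with `x` or a point
preferred to `x` belong to `ψ'`, then `p` and `x` are also matched in `(φ, ψ')`. -/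
theorem MatchedAt.matched_of_chains_mem {φ ψ ψ' : Config d} (hsub : ψ'.carrier ⊆ ψ.carrier)
    {n : ℕ} (h : MatchedAt φ.carrier ψ.carrier n p x)
    (hchain : ∀ m z, IsDescendingChain φ.carrier ψ.carrier m z → z 1 = p →
      (z 2 = x ∨ FirstPrefers p (z 2) x) → ∀ i, 1 ≤ i → i ≤ m → Even i → z i ∈ ψ'.carrier) :
    Matched φ.carrier ψ'.carrier p x := by
  induction n using Nat.strong_induction_on generalizing p x with
  | _ n ih =>
    have hp : p ∈ φ.carrier := Matched.fst_mem ⟨n, h⟩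
    have hx : x ∈ ψ.carrier := Matched.snd_mem ⟨n, h⟩
    have hpx : IsDescendingChain φ.carrier ψ.carrier 2 (fun i => if i = 1 then p else x) := by
      refine ⟨le_rfl, fun i hi hin ho => ?_, fun i hi hin he => ?_, by lia, by lia⟩
      · obtain rfl : i = 1 := by grind
        exact hp
      · obtain rfl : i = 2 := by grind
        exact hx
    have hx' : x ∈ ψ'.carrier := by
      simpa using hchain 2 _ hpx (by simp) (by simp) 2 (by simp) le_rfl (by decide)
    refine matched_of_forall_better hp hx' (fun y hy hyx => ?_) (fun q hq hqp => ?_)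
    · obtain ⟨m, hm, q, hqy, hyqp⟩ := h.exists_of_firstPrefers (hsub hy) hyx
      refine ⟨q, ih m hm hqy fun k z hz hz1 hz2 i hi hik hie => ?_, hyqp⟩
      -- Chains for `(q, y)` must become chains for `(p, x)`. If the chain passes through `y`
      -- itself, `p` can replace `q`, since `y` prefers `q` to `p`; otherwise `p, y` is put in
      -- front.
      rcases hz2 with hz2 | hz2
      · have h1 : i ≠ 1 := by rintro rfl; exact absurd hie (by decide)
        have := hchain k _ (hz.update_first hp (by rwa [hz1, hz2])) (by simp)
          (by simp [hz2, hyx]) i hi hik hie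
        simpa [h1] using this
      · have := hchain (k + 2) _ (hz.prependTwo hp (hsub hy) (by rwa [hz1]) (by rwa [hz1])) rfl
          (Or.inr hyx) (i + 2) (by lia) (by lia) (by grind)
        match i, hi, this with
        | i + 1, _, this => exact this
    · obtain ⟨m, hm, y, hqy, hqyx⟩ := h.exists_of_secondPrefers hq hqp
      refine ⟨y, ih m hm hqy fun k z hz hz1 hz2 i hi hik hie => ?_, hqyx⟩
      -- In both cases `q` prefers `z 2` to `x`, so `p, x` can be put in front of the chain.
      have hz2' : FirstPrefers q (z 2) x := by
        rcases hz2 with hz2 | hz2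
        · rwa [hz2]
        · exact hz2.trans hqyx
      have := hchain (k + 2) _ (hz.prependTwo hp hx (by rwa [hz1]) (by rwa [hz1])) rfl
          (Or.inl rfl) (i + 2) (by lia) (by lia) (by grind)
      match i, hi, this with
      | i + 1, _, this => exact this

/-- The partner of `p` is determined by the points inside any set that contains the flower. -/
theorem Matched.restrict_of_flower_subset {φ ψ : Config d} {B : Set (Space d)}
    (h : Matched φ.carrier ψ.carrier p x) (hB : flower φ ψ p ⊆ B) :
    Matched φ.carrier (ψ.restrict B).carrier p x := by
  obtain ⟨n, hn⟩ := id h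
  refine MatchedAt.matched_of_chains_mem (ψ' := ψ.restrict B) Set.inter_subset_left hn
    fun m z hz hz1 hz2 i hi him hie => ⟨hz.mem_second i hi him hie, hB ?_⟩
  rw [flower, if_pos ⟨x, h⟩]
  refine ⟨m, z, ⟨hz, hz1, x, h, hz2⟩, Or.inr ?_⟩
  have h2 : 2 ≤ i := by grind
  exact Set.mem_biUnion (⟨h2, him⟩ : i ∈ Set.Icc 2 m) (Metric.mem_closedBall_self dist_nonneg)

theorem Matched.mem_flower {φ ψ : Config d} (h : Matched φ.carrier ψ.carrier p x) :
    x ∈ flower φ ψ p := by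
  rw [flower, if_pos ⟨x, h⟩]
  refine ⟨2, fun i => if i = 1 then p else x, ⟨⟨le_rfl, fun i hi hin ho => ?_,
    fun i hi hin he => ?_, by lia, by lia⟩, by simp, x, h, by simp⟩, Or.inl (by simp [dist_comm])⟩
  · obtain rfl : i = 1 := by grind
    exact h.fst_mem
  · obtain rfl : i = 2 := by grind
    exact h.snd_mem

/-- The flower of an unmatched point is the whole space, which is unbounded only because `1 ≤ d`. -/
theorem exists_matched_of_flower_subset_closedBall (hd : 1 ≤ d) {φ ψ : Config d} {c : Space d}
    {r : ℝ} (h : flower φ ψ p ⊆ Metric.closedBall c r) :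
    ∃ x, Matched φ.carrier ψ.carrier p x := by
  by_contra hcon
  rw [flower, if_neg hcon] at h
  have : Nonempty (Fin d) := ⟨⟨0, hd⟩⟩
  exact NormedSpace.unbounded_univ ℝ (Space d) (Metric.isBounded_closedBall.subset h)

end Locality

/-! ### Covariance of the matching under lattice translations -/

section Shift

variable {d : ℕ} {v : Space d} {φ ψ φ' ψ' : Set (Space d)}

theorem lexLT_iff {x y : Space d} : LexLT x y ↔ ∃ i, (∀ j < i, x j = y j) ∧ x i < y i := Iff.rfl

theorem firstPrefers_add_right {p x y : Space d} :
    FirstPrefers (p + v) (x + v) (y + v) ↔ FirstPrefers p x y := by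
  simp [FirstPrefers, lexLT_iff]

theorem secondPrefers_add_right {x p q : Space d} :
    SecondPrefers (x + v) (p + v) (q + v) ↔ SecondPrefers x p q := by
  simp [SecondPrefers, lexLT_iff]

theorem mutualNearest_add_right (hφ : ∀ x, x + v ∈ φ' ↔ x ∈ φ) (hψ : ∀ x, x + v ∈ ψ' ↔ x ∈ ψ)
    {p x : Space d} : MutualNearest φ' ψ' (p + v) (x + v) ↔ MutualNearest φ ψ p x := by
  rw [MutualNearest, MutualNearest, isNearestMin_iff, isNearestMin_iff, isNearestMax_iff,
    isNearestMax_iff, hφ, hψ, ← (Equiv.addRight v).forall_congr_right,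
    ← (Equiv.addRight v).forall_congr_right (q := fun q => q ∈ φ' → ¬ SecondPrefers (x + v) q _)]
  simp only [Equiv.coe_addRight, hφ, hψ, firstPrefers_add_right, secondPrefers_add_right]

theorem remaining_add_right (hφ : ∀ x, x + v ∈ φ' ↔ x ∈ φ) (hψ : ∀ x, x + v ∈ ψ' ↔ x ∈ ψ)
    (n : ℕ) : (∀ x, x + v ∈ (remaining φ' ψ' n).1 ↔ x ∈ (remaining φ ψ n).1) ∧
      ∀ x, x + v ∈ (remaining φ' ψ' n).2 ↔ x ∈ (remaining φ ψ n).2 := by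
  induction n with
  | zero => exact ⟨hφ, hψ⟩
  | succ n ih =>
    refine ⟨fun x => and_congr (ih.1 x) (not_congr ?_), fun x => and_congr (ih.2 x) (not_congr ?_)⟩
    · rw [← (Equiv.addRight v).exists_congr_right]
      simp only [Equiv.coe_addRight, mutualNearest_add_right ih.1 ih.2]
    · rw [← (Equiv.addRight v).exists_congr_right]
      simp only [Equiv.coe_addRight, mutualNearest_add_right ih.1 ih.2]

theorem matched_add_right (hφ : ∀ x, x + v ∈ φ' ↔ x ∈ φ) (hψ : ∀ x, x + v ∈ ψ' ↔ x ∈ ψ)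
    {p x : Space d} : Matched φ' ψ' (p + v) (x + v) ↔ Matched φ ψ p x :=
  exists_congr fun n => mutualNearest_add_right (remaining_add_right hφ hψ n).1
    (remaining_add_right hφ hψ n).2

theorem Config.add_mem_shift_iff {φ : Config d} {x v : Space d} :
    x + v ∈ (φ.shift v).carrier ↔ x ∈ φ.carrier := by
  simp [Config.shift]

theorem latticePoint_add (w v : Fin d → ℤ) :
    latticePoint (w + v) = latticePoint w + latticePoint v := by
  ext i
  simp [latticePoint]

theorem latticePoint_sub (w v : Fin d → ℤ) :
    latticePoint (w - v) = latticePoint w - latticePoint v := by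
  ext i
  simp [latticePoint]

@[simp]
theorem latticePoint_zero : latticePoint (0 : Fin d → ℤ) = 0 := by
  ext i
  simp [latticePoint]

theorem latticePoint_injective : Function.Injective (latticePoint : (Fin d → ℤ) → Space d) := by
  intro w v h
  funext i
  simpa [latticePoint] using congrArg (fun x : Space d => x i) h

theorem add_latticePoint_mem_lattice {x : Space d} (w : Fin d → ℤ) :
    x + latticePoint w ∈ (lattice d).carrier ↔ x ∈ (lattice d).carrier := by
  constructor
  · rintro ⟨u, hu⟩
    exact ⟨u - w, by rw [latticePoint_sub, hu, add_sub_cancel_right]⟩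
  · rintro ⟨u, rfl⟩
    exact ⟨u + w, latticePoint_add u w⟩

/-- `x` is the partner of the lattice point with coordinates `w` when `φ` is matched to the
lattice. -/
def Partner (φ : Config d) (w : Fin d → ℤ) (x : Space d) : Prop :=
  Matched (lattice d).carrier φ.carrier (latticePoint w) x

theorem partner_shift {φ : Config d} {w : Fin d → ℤ} {x : Space d} (v : Fin d → ℤ) :
    Partner (φ.shift (latticePoint v)) (w + v) (x + latticePoint v) ↔ Partner φ w x := by
  rw [Partner, Partner, latticePoint_add]
  exact matched_add_right (fun _ => add_latticePoint_mem_lattice v)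
    fun _ => Config.add_mem_shift_iff

@[ext]
theorem Config.ext {φ ψ : Config d} (h : φ.carrier = ψ.carrier) : φ = ψ := by
  cases φ; cases ψ; cases h; rfl

/-- The partner of the lattice point `w` when only the points of `φ` at distance at most `ρ` of
`w` are matched to the lattice. -/
def LocalPartner (ρ : ℝ) (φ : Config d) (w : Fin d → ℤ) (x : Space d) : Prop :=
  Partner (φ.restrict (Metric.closedBall (latticePoint w) ρ)) w x

theorem localPartner_shift {ρ : ℝ} {φ : Config d} {w : Fin d → ℤ} {x : Space d}
    (v : Fin d → ℤ) :
    LocalPartner ρ (φ.shift (latticePoint v)) (w + v) (x + latticePoint v) ↔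
      LocalPartner ρ φ w x := by
  have : (φ.shift (latticePoint v)).restrict (Metric.closedBall (latticePoint (w + v)) ρ) =
      (φ.restrict (Metric.closedBall (latticePoint w) ρ)).shift (latticePoint v) := by
    ext y
    obtain ⟨y, rfl⟩ : ∃ y', y = y' + latticePoint v := ⟨y - latticePoint v, by simp⟩
    rw [Config.add_mem_shift_iff]
    simp [Config.restrict, Config.add_mem_shift_iff, latticePoint_add]
  rw [LocalPartner, LocalPartner, this, partner_shift]

/-- The bounded flower provides a partner that survives the restriction; uniqueness of partners,
before and after restricting, then gives both directions. -/
theorem partner_iff_localPartner_of_flower_subset (hd : 1 ≤ d) {φ : Config d} {ρ : ℝ}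
    (h : flower (lattice d) φ 0 ⊆ Metric.closedBall 0 ρ) (x : Space d) :
    Partner φ 0 x ↔ LocalPartner ρ φ 0 x := by
  obtain ⟨y, hy⟩ := exists_matched_of_flower_subset_closedBall hd h
  rw [LocalPartner, Partner, Partner, latticePoint_zero]
  have hy' := hy.restrict_of_flower_subset h
  exact ⟨fun hx => hx.snd_unique hy ▸ hy', fun hx => hx.snd_unique hy' ▸ hy⟩

end Shift

/-! ### Joint measurability of the matching -/

section Measurability

variable {d : ℕ} {α : Type*} [MeasurableSpace α]

theorem Config.measurable_count {B : Set (Space d)} (hB : MeasurableSet B) :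
    Measurable fun φ : Config d => φ.count B := by
  rw [measurable_iff_comap_le]
  exact le_iSup₂_of_le (f := fun (B : Set (Space d)) (_ : MeasurableSet B) =>
    MeasurableSpace.comap (fun φ : Config d => φ.count B) ⊤) B hB le_rfl

theorem Config.measurable_of_count {g : α → Config d}
    (h : ∀ B, MeasurableSet B → Measurable fun a => (g a).count B) : Measurable g := by
  rw [measurable_iff_comap_le]
  simp only [instMeasurableSpace, MeasurableSpace.comap_iSup, MeasurableSpace.comap_comp]
  exact iSup₂_le fun B hB => (h B hB).comap_le

theorem Config.measurable_restrict {A : Set (Space d)} (hA : MeasurableSet A) :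
    Measurable fun φ : Config d => φ.restrict A := by
  refine Config.measurable_of_count fun B hB => ?_
  have : (fun φ : Config d => (φ.restrict A).count B) = fun φ => φ.count (A ∩ B) := by
    funext φ
    simp [count, restrict, Set.inter_assoc]
  rw [this]
  exact Config.measurable_count (hA.inter hB)

theorem Config.measurable_shift (v : Space d) :
    Measurable fun φ : Config d => φ.shift v := by
  refine Config.measurable_of_count fun B hB => ?_
  have : (fun φ : Config d => (φ.shift v).count B) = fun φ => φ.count ((fun y => y + v) ⁻¹' B) := by
    funext φ
    rw [count, count, ← (add_left_injective v).encard_image (φ.carrier ∩ _),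
      Set.image_inter_preimage]
    rfl
  rw [this]
  exact Config.measurable_count (measurable_add_const v hB)

/-- The existence of a point of a random configuration with a jointly measurable property is
measurable. -/
theorem measurableSet_exists_mem {g : α → Config d} (hg : Measurable g) {H : Set (α × Space d)}
    (hH : MeasurableSet H) : MeasurableSet {a | ∃ y ∈ (g a).carrier, (a, y) ∈ H} := by
  have hfin : ∀ a (n : ℕ), ((g a).carrier ∩ Metric.closedBall 0 n).Finite := fun a n =>
    (g a).locallyFinite _ Metric.isBounded_closedBall
  have happ : ∀ (n : ℕ) a {S : Set (Space d)}, MeasurableSet S →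
      Measure.count.restrict ((g a).carrier ∩ Metric.closedBall 0 n) S =
        (g a).count (Metric.closedBall 0 n ∩ S) := by
    intro n a S hS
    rw [Measure.restrict_apply hS, Measure.count_apply (hS.inter (hfin a n).measurableSet),
      Config.count, Set.inter_comm S, Set.inter_assoc]
  -- Counting measure on the points in the ball of radius `n` is a kernel with finite values, so the
  -- mass of a section of `H` is measurable; a point with the property exists iff this mass is
  -- nonzero for some `n`.
  let κ : ℕ → Kernel α (Space d) := fun n =>
    ⟨fun a => Measure.count.restrict ((g a).carrier ∩ Metric.closedBall 0 n), by
      refine Measure.measurable_of_measurable_coe _ fun S hS => ?_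
      simp only [happ n _ hS]
      exact (measurable_from_top (f := fun k : ℕ∞ => (k : ℝ≥0∞))).comp
        ((Config.measurable_count (measurableSet_closedBall.inter hS)).comp hg)⟩
  have hκ : ∀ n a, IsFiniteMeasure (κ n a) := fun n a =>
    ⟨by
      change Measure.count.restrict _ Set.univ < ∞
      rw [Measure.restrict_apply_univ, Measure.count_apply_lt_top]
      exact hfin a n⟩
  have heq : {a | ∃ y ∈ (g a).carrier, (a, y) ∈ H} =
      ⋃ n, {a | κ n a (Prod.mk a ⁻¹' H) ≠ 0} := by
    ext a
    simp only [Set.mem_ofPred_eq, Set.mem_iUnion]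
    have : ∀ n, κ n a (Prod.mk a ⁻¹' H) =
        ((g a).count (Metric.closedBall 0 n ∩ Prod.mk a ⁻¹' H) : ℕ∞) := fun n =>
      happ n a (measurable_prodMk_left hH)
    have hpos : ∀ S : Set (Space d), (S.encard : ℝ≥0∞) ≠ 0 ↔ S.Nonempty := fun S => by
      rw [Set.nonempty_iff_ne_empty, ← ENat.toENNReal_zero, ne_eq, ENat.toENNReal_inj,
        Set.encard_eq_zero]
    simp only [this, Config.count, hpos]
    constructor
    · rintro ⟨y, hy, hyH⟩
      obtain ⟨n, hn⟩ := exists_nat_ge ‖y‖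
      exact ⟨n, y, hy, by simpa using hn, hyH⟩
    · rintro ⟨n, y, hy, -, hyH⟩
      exact ⟨y, hy, hyH⟩
  rw [heq]
  exact MeasurableSet.iUnion fun n => Kernel.measurable_kernel_prodMk_left_of_finite hH (hκ n)
    (measurableSet_singleton 0).compl

/-- Membership is the existence of a point of the configuration on the diagonal. -/
theorem measurableSet_mem_carrier :
    MeasurableSet {a : Config d × Space d | a.2 ∈ a.1.carrier} := by
  convert! measurableSet_exists_mem (d := d) (α := Config d × Space d) measurable_fst
    (H := {b | b.2 = b.1.2}) (measurableSet_eq_fun measurable_snd measurable_fst.snd) using 1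
  ext a
  simp

theorem measurable_coord (i : Fin d) : Measurable fun x : Space d => x i :=
  (EuclideanSpace.proj (𝕜 := ℝ) i).continuous.measurable

theorem measurableSet_lexLT {f g : α → Space d} (hf : Measurable f) (hg : Measurable g) :
    MeasurableSet {a | LexLT (f a) (g a)} := by
  simp only [lexLT_iff, Set.ofPred_exists, Set.ofPred_and, Set.ofPred_forall]
  refine MeasurableSet.iUnion fun i => MeasurableSet.inter
    (MeasurableSet.iInter fun j => MeasurableSet.iInter fun _ => ?_) ?_
  · exact measurableSet_eq_fun ((measurable_coord j).comp hf) ((measurable_coord j).comp hg)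
  · exact measurableSet_lt ((measurable_coord i).comp hf) ((measurable_coord i).comp hg)

theorem measurableSet_firstPrefers {f g h : α → Space d} (hf : Measurable f) (hg : Measurable g)
    (hh : Measurable h) : MeasurableSet {a | FirstPrefers (f a) (g a) (h a)} :=
  (measurableSet_lt (hg.dist hf) (hh.dist hf)).union
    ((measurableSet_eq_fun (hg.dist hf) (hh.dist hf)).inter (measurableSet_lexLT hg hh))

theorem measurableSet_secondPrefers {f g h : α → Space d} (hf : Measurable f) (hg : Measurable g)
    (hh : Measurable h) : MeasurableSet {a | SecondPrefers (f a) (g a) (h a)} :=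
  (measurableSet_lt (hg.dist hf) (hh.dist hf)).union
    ((measurableSet_eq_fun (hg.dist hf) (hh.dist hf)).inter (measurableSet_lexLT hh hg))

/-- Joint measurability of the matching in one round, given that of the sets of points that are
still unmatched. -/
theorem measurableSet_matchedAt_of_remaining {n : ℕ}
    (hU : ∀ w : Fin d → ℤ, MeasurableSet
      {φ : Config d | latticePoint w ∈ (remaining (lattice d).carrier φ.carrier n).1})
    (hV : MeasurableSet {a : Config d × Space d |
      a.2 ∈ (remaining (lattice d).carrier a.1.carrier n).2}) (w : Fin d → ℤ) :
    MeasurableSet {a : Config d × Space d |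
      MatchedAt (lattice d).carrier a.1.carrier n (latticePoint w) a.2} := by
  -- The two ways to fail: a better point of the configuration, handled by
  -- `measurableSet_exists_mem`, or a better lattice point, handled by a countable union.
  have h₁ : MeasurableSet {a : Config d × Space d | ∃ y ∈ a.1.carrier, (a, y) ∈
      {b : (Config d × Space d) × Space d |
        b.2 ∈ (remaining (lattice d).carrier b.1.1.carrier n).2 ∧
          FirstPrefers (latticePoint w) b.2 b.1.2}} := by
    refine measurableSet_exists_mem measurable_fst (MeasurableSet.inter ?_ ?_)
    · exact (measurable_fst.fst.prodMk measurable_snd) hV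
    · exact measurableSet_firstPrefers measurable_const measurable_snd measurable_fst.snd
  have h₂ : MeasurableSet (⋃ v : Fin d → ℤ, {a : Config d × Space d |
      latticePoint v ∈ (remaining (lattice d).carrier a.1.carrier n).1 ∧
        SecondPrefers a.2 (latticePoint v) (latticePoint w)}) :=
    MeasurableSet.iUnion fun v => (measurable_fst (hU v)).inter
      (measurableSet_secondPrefers measurable_snd measurable_const measurable_const)
  convert! (hV.inter h₁.compl).inter ((measurable_fst (hU w)).inter h₂.compl) using 1
  ext ⟨φ, x⟩
  simp only [Set.mem_ofPred_eq, matchedAt_iff, Set.mem_inter_iff, Set.mem_compl_iff, Set.mem_iUnion,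
    Set.mem_preimage, not_exists, not_and]
  refine and_congr (and_congr_right fun _ => ?_) (and_congr_right fun _ => ?_)
  · exact ⟨fun h y _ => h y, fun h y hy => h y (mem_remaining_snd_iff.mp hy).1 hy⟩
  · refine ⟨fun h v => h _, fun h q hq => ?_⟩
    obtain ⟨v, rfl⟩ := (mem_remaining_fst_iff.mp hq).1
    exact h v hq

theorem measurableSet_remaining (n : ℕ) :
    (∀ w : Fin d → ℤ, MeasurableSet
      {φ : Config d | latticePoint w ∈ (remaining (lattice d).carrier φ.carrier n).1}) ∧
    MeasurableSet {a : Config d × Space d |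
      a.2 ∈ (remaining (lattice d).carrier a.1.carrier n).2} := by
  induction n with
  | zero =>
    refine ⟨fun w => ?_, measurableSet_mem_carrier⟩
    have : latticePoint w ∈ (lattice d).carrier := ⟨w, rfl⟩
    simp [remaining, this]
  | succ n ih =>
    have hM := measurableSet_matchedAt_of_remaining ih.1 ih.2
    refine ⟨fun w => ?_, ?_⟩
    · convert! (ih.1 w).inter (measurableSet_exists_mem measurable_id (hM w)).compl using 1
      ext φ
      refine and_congr_right fun _ => not_congr (exists_congr fun x => ⟨fun h => ⟨?_, h⟩, And.right⟩)
      exact Matched.snd_mem ⟨n, h⟩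
    · convert! ih.2.inter (MeasurableSet.iUnion hM).compl using 1
      ext a
      refine and_congr_right fun _ => not_congr ?_
      simp only [Set.mem_iUnion, Set.mem_ofPred_eq]
      refine ⟨fun ⟨p, hp⟩ => ?_, fun ⟨w, hw⟩ => ⟨_, hw⟩⟩
      obtain ⟨w, rfl⟩ := Matched.fst_mem ⟨n, hp⟩
      exact ⟨w, hp⟩

theorem measurableSet_partner (w : Fin d → ℤ) :
    MeasurableSet {a : Config d × Space d | Partner a.1 w a.2} := by
  convert! MeasurableSet.iUnion fun n => measurableSet_matchedAt_of_remaining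
    (measurableSet_remaining (d := d) n).1 (measurableSet_remaining n).2 w using 1
  ext a
  simp [Partner, Matched, MatchedAt]

theorem measurableSet_localPartner (ρ : ℝ) (w : Fin d → ℤ) :
    MeasurableSet {a : Config d × Space d | LocalPartner ρ a.1 w a.2} :=
  (((Config.measurable_restrict measurableSet_closedBall).comp measurable_fst).prodMk
    measurable_snd) (measurableSet_partner w)

end Measurability

/-! ### Unit cells and counting lattice points -/

section Cells

variable {d : ℕ}

/-- The half-open unit cube with lowest corner `z`. -/
def cell (z : Fin d → ℤ) : Set (Space d) := {x | ∀ i, ⌊x i⌋ = z i}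

theorem measurableSet_cell (z : Fin d → ℤ) : MeasurableSet (cell z) := by
  rw [cell, Set.ofPred_forall]
  exact MeasurableSet.iInter fun i =>
    (Int.measurable_floor.comp (measurable_coord i)) (measurableSet_singleton (z i))

theorem mem_cell_floor (x : Space d) : x ∈ cell fun i => ⌊x i⌋ := fun _ => rfl

theorem pairwise_disjoint_cell :
    Pairwise (Function.onFun Disjoint (cell : (Fin d → ℤ) → Set (Space d))) := by
  intro z z' hne
  refine Set.disjoint_left.mpr fun x hx hx' => hne (funext fun i => ?_)
  rw [← hx i, ← hx' i]

theorem preimage_add_cell (w z : Fin d → ℤ) :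
    (fun x => x + latticePoint w) ⁻¹' cell z = cell (z - w) := by
  ext x
  refine forall_congr' fun i => ?_
  simp [latticePoint, eq_sub_iff_add_eq]

theorem volume_cell (z : Fin d → ℤ) : volume (cell z) = 1 := by
  have : cell z = (MeasurableEquiv.toLp 2 (Fin d → ℝ)).symm ⁻¹'
      Set.univ.pi fun i => Set.Ico (z i : ℝ) (z i + 1) := by
    ext x
    simp [cell, Int.floor_eq_iff]
  rw [this, (EuclideanSpace.volume_preserving_symm_measurableEquiv_toLp (Fin d)).measure_preimage
    (MeasurableSet.univ_pi fun _ => measurableSet_Ico).nullMeasurableSet, Real.volume_pi_Ico]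
  simp

/-- The diameter of the unit cube gives `√d`; the cruder `d` avoids square roots later. -/
theorem dist_latticePoint_le_of_mem_cell {x : Space d} {z : Fin d → ℤ} (hx : x ∈ cell z) :
    dist x (latticePoint z) ≤ d := by
  rw [EuclideanSpace.dist_eq]
  refine Real.sqrt_le_iff.mpr ⟨by positivity, ?_⟩
  have : ∀ i, dist (x i) ((latticePoint z) i) ^ 2 ≤ 1 := fun i => by
    rw [show (latticePoint z) i = (z i : ℝ) from rfl, Real.dist_eq, ← hx i, sq_abs, Int.self_sub_floor]
    nlinarith [Int.fract_nonneg (x i), Int.fract_lt_one (x i)]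
  calc ∑ i, dist (x i) ((latticePoint z) i) ^ 2 ≤ ∑ _i : Fin d, (1 : ℝ) :=
        Finset.sum_le_sum fun i _ => this i
    _ = d := by simp
    _ ≤ (d : ℝ) ^ 2 := by exact_mod_cast Nat.le_self_pow two_ne_zero d

/-- The number of lattice points in a set is at most the volume of a neighbourhood of the set. -/
theorem card_le_volume_cthickening {S : Set (Space d)} {Z : Finset (Fin d → ℤ)}
    (hZ : ∀ z ∈ Z, latticePoint z ∈ S) :
    (Z.card : ℝ≥0∞) ≤ volume (Metric.cthickening d S) := by
  calc (Z.card : ℝ≥0∞) = ∑ z ∈ Z, volume (cell z) := by simp [volume_cell]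
    _ = volume (⋃ z ∈ Z, cell z) :=
        (measure_biUnion_finset (fun z _ z' _ h => pairwise_disjoint_cell h)
          fun z _ => measurableSet_cell z).symm
    _ ≤ volume (Metric.cthickening d S) := measure_mono (Set.iUnion₂_subset fun z hz x hx =>
        Metric.mem_cthickening_of_dist_le x _ _ _ (hZ z hz) (dist_latticePoint_le_of_mem_cell hx))

theorem finite_latticePoint_mem {S : Set (Space d)} (hS : Bornology.IsBounded S) :
    {z : Fin d → ℤ | latticePoint z ∈ S}.Finite := by
  refine Set.Finite.of_finite_image (((lattice d).locallyFinite S hS).subset ?_)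
    latticePoint_injective.injOn
  rintro _ ⟨z, hz, rfl⟩
  exact ⟨⟨z, rfl⟩, hz⟩

/-- The lattice points in the closed ball of radius `L` around the origin. -/
noncomputable def latticeBall (d : ℕ) (L : ℝ) : Finset (Fin d → ℤ) :=
  (finite_latticePoint_mem (d := d) (S := Metric.closedBall 0 L)
    Metric.isBounded_closedBall).toFinset

theorem mem_latticeBall {L : ℝ} {z : Fin d → ℤ} :
    z ∈ latticeBall d L ↔ ‖latticePoint z‖ ≤ L := by
  simp [latticeBall]

theorem exists_card_latticeBall_le (d : ℕ) :
    ∃ K : ℝ, 0 < K ∧ ∀ L : ℝ, 1 ≤ L → ((latticeBall d L).card : ℝ) ≤ K * L ^ d := by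
  have hfin : volume (Metric.closedBall (0 : Space d) (1 + d)) ≠ ∞ :=
    measure_closedBall_lt_top.ne
  refine ⟨(volume (Metric.closedBall (0 : Space d) (1 + d))).toReal + 1, by positivity,
    fun L hL => ?_⟩
  have h1 := card_le_volume_cthickening (S := Metric.closedBall (0 : Space d) L)
    (Z := latticeBall d L) fun z hz => by simpa using mem_latticeBall.mp hz
  have h2 : volume (Metric.cthickening d (Metric.closedBall (0 : Space d) L)) ≤
      ENNReal.ofReal (L ^ d) * volume (Metric.closedBall (0 : Space d) (1 + d)) := by
    rw [cthickening_closedBall (by positivity) (by positivity)]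
    refine (measure_mono (Metric.closedBall_subset_closedBall
      (ε₂ := L * (1 + d)) ?_)).trans_eq ?_
    · nlinarith [(Nat.cast_nonneg d : (0 : ℝ) ≤ d)]
    · rw [Measure.addHaar_closedBall_mul _ _ (by positivity) (by positivity)]
      simp
  have h3 := ENNReal.toReal_mono (ENNReal.mul_ne_top ENNReal.ofReal_ne_top hfin) (h1.trans h2)
  rw [ENNReal.toReal_mul, ENNReal.toReal_ofReal (by positivity), ENNReal.toReal_natCast] at h3
  nlinarith [pow_nonneg (zero_le_one.trans hL) d]

theorem subset_biUnion_cell {A : Set (Space d)} {L : ℝ} (hA : A ⊆ Metric.closedBall 0 L) :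
    A ⊆ ⋃ z ∈ latticeBall d (L + d), cell z := by
  intro x hx
  refine Set.mem_biUnion ?_ (mem_cell_floor x)
  have h1 := dist_latticePoint_le_of_mem_cell (mem_cell_floor x)
  have h2 : ‖x‖ ≤ L := by simpa using hA hx
  rw [Finset.mem_coe, mem_latticeBall]
  calc _ = ‖x - (x - latticePoint fun i => ⌊x i⌋)‖ := by simp
    _ ≤ _ := norm_sub_le _ _
    _ ≤ _ := by rw [← dist_eq_norm x]; linarith

end Cells

/-! ### Mass transport from the lattice to the configuration -/

section MassTransport

variable {d : ℕ}

/-- A measurable and translation covariant choice of at most one point of a configuration for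
every lattice point. -/
structure IsTransport (T : Config d → (Fin d → ℤ) → Space d → Prop) : Prop where
  measurableSet : ∀ w, MeasurableSet {a : Config d × Space d | T a.1 w a.2}
  mem : ∀ {φ w x}, T φ w x → x ∈ φ.carrier
  unique : ∀ {φ w x y}, T φ w x → T φ w y → x = y
  shift : ∀ {φ w x} v, T (φ.shift (latticePoint v)) (w + v) (x + latticePoint v) ↔ T φ w x

theorem isTransport_partner : IsTransport (Partner (d := d)) where
  measurableSet := measurableSet_partner
  mem h := Matched.snd_mem h
  unique h h' := Matched.snd_unique h h'
  shift := partner_shift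

theorem isTransport_localPartner (ρ : ℝ) : IsTransport (LocalPartner (d := d) ρ) where
  measurableSet := measurableSet_localPartner ρ
  mem h := (Matched.snd_mem h).1
  unique h h' := Matched.snd_unique h h'
  shift := localPartner_shift

variable {T T' : Config d → (Fin d → ℤ) → Space d → Prop}

theorem IsTransport.and_not (hT : IsTransport T) (hT' : IsTransport T') :
    IsTransport fun φ w x => T φ w x ∧ ¬ T' φ w x where
  measurableSet w := (hT.measurableSet w).inter (hT'.measurableSet w).compl
  mem h := hT.mem h.1
  unique h h' := hT.unique h.1 h'.1
  shift v := and_congr (hT.shift v) (not_congr (hT'.shift v))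

theorem IsTransport.and_lt_dist (hT : IsTransport T) (R : ℝ) :
    IsTransport fun φ w x => T φ w x ∧ R < dist x (latticePoint w) where
  measurableSet w := (hT.measurableSet w).inter
    (measurableSet_lt measurable_const (measurable_snd.dist measurable_const))
  mem h := hT.mem h.1
  unique h h' := hT.unique h.1 h'.1
  shift v := and_congr (hT.shift v) (by rw [latticePoint_add, dist_add_right])

/-- The event that the point chosen for `w` belongs to `A`. -/
def hitEvent (T : Config d → (Fin d → ℤ) → Space d → Prop) (w : Fin d → ℤ) (A : Set (Space d)) :
    Set (Config d) := {φ | ∃ x ∈ A, T φ w x}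

theorem hitEvent_mono {w : Fin d → ℤ} {A B : Set (Space d)} (h : A ⊆ B) :
    hitEvent T w A ⊆ hitEvent T w B :=
  fun _ ⟨x, hx, hxT⟩ => ⟨x, h hx, hxT⟩

theorem IsTransport.measurableSet_hitEvent (hT : IsTransport T) (w : Fin d → ℤ)
    {A : Set (Space d)} (hA : MeasurableSet A) : MeasurableSet (hitEvent T w A) := by
  convert! measurableSet_exists_mem (d := d) measurable_id
    ((measurable_snd hA).inter (hT.measurableSet w)) using 1
  ext φ
  exact exists_congr fun x => ⟨fun h => ⟨hT.mem h.2, h⟩, fun h => h.2⟩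

variable {μ : Measure (Config d)}
  (hμ : ∀ v : Fin d → ℤ, μ.map (fun φ => φ.shift (latticePoint v)) = μ)

include hμ in
theorem IsTransport.measure_hitEvent (hT : IsTransport T) (w : Fin d → ℤ) {A : Set (Space d)}
    (hA : MeasurableSet A) :
    μ (hitEvent T w A) = μ (hitEvent T 0 ((fun x => x + latticePoint w) ⁻¹' A)) := by
  conv_lhs => rw [← hμ w]
  rw [Measure.map_apply (Config.measurable_shift _) (hT.measurableSet_hitEvent w hA)]
  congr 1
  ext φ
  have : ∀ x, T φ 0 x ↔ T (φ.shift (latticePoint w)) w (x + latticePoint w) := fun x => by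
    rw [← hT.shift w, zero_add]
  simp only [hitEvent, Set.mem_preimage, Set.mem_ofPred_eq, this]
  rw [← (Equiv.addRight (latticePoint w)).exists_congr_right]
  rfl

include hμ in
/-- Mass transport: the expected number of lattice points sent to a set covered by finitely many
cells. -/
theorem IsTransport.tsum_measure_hitEvent_le (hT : IsTransport T) {A : Set (Space d)}
    {Z : Finset (Fin d → ℤ)} (hZ : A ⊆ ⋃ z ∈ Z, cell z) :
    ∑' w, μ (hitEvent T w A) ≤ Z.card * μ (hitEvent T 0 Set.univ) := by
  have hcell : ∀ z, ∑' w, μ (hitEvent T w (cell z)) ≤ μ (hitEvent T 0 Set.univ) := by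
    intro z
    -- Invariance converts mass received by one cell into mass sent by the origin to the cells `z -
    -- w`. These events are disjoint, as the origin chooses at most one point.
    have h1 : ∀ w, μ (hitEvent T w (cell z)) = μ (hitEvent T 0 (cell (z - w))) := fun w => by
      rw [hT.measure_hitEvent hμ w (measurableSet_cell z), preimage_add_cell]
    simp only [h1]
    rw [← measure_iUnion]
    · exact measure_mono (Set.iUnion_subset fun w => hitEvent_mono (Set.subset_univ _))
    · intro w w' hne
      refine Set.disjoint_left.mpr ?_
      rintro φ ⟨x, hx, hxT⟩ ⟨y, hy, hyT⟩
      rw [hT.unique hyT hxT] at hy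
      exact Set.disjoint_left.mp (pairwise_disjoint_cell (sub_right_injective.ne hne)) hx hy
    · exact fun w => hT.measurableSet_hitEvent 0 (measurableSet_cell _)
  have hsub : ∀ w, hitEvent T w A ⊆ ⋃ z ∈ Z, hitEvent T w (cell z) := by
    rintro w φ ⟨x, hx, hxT⟩
    obtain ⟨z, hz, hxz⟩ := Set.mem_iUnion₂.mp (hZ hx)
    exact Set.mem_biUnion hz ⟨x, hxz, hxT⟩
  calc ∑' w, μ (hitEvent T w A) ≤ ∑' w, ∑ z ∈ Z, μ (hitEvent T w (cell z)) :=
        ENNReal.tsum_le_tsum fun w =>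
          (measure_mono (hsub w)).trans (measure_biUnion_finset_le _ _)
    _ = ∑ z ∈ Z, ∑' w, μ (hitEvent T w (cell z)) :=
        Summable.tsum_finsetSum fun _ _ => ENNReal.summable
    _ ≤ ∑ z ∈ Z, μ (hitEvent T 0 Set.univ) := Finset.sum_le_sum fun z _ => hcell z
    _ = Z.card * μ (hitEvent T 0 Set.univ) := by simp

end MassTransport

/-! ### Covariances of events and variance of sums of indicators -/

section EventCovariance

variable {α : Type*} [MeasurableSpace α] {μ : Measure α} [IsProbabilityMeasure μ]
  {E E' F F' : Set α}

/-- The covariance of the indicators of two events. -/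
noncomputable def eventCov (μ : Measure α) (E F : Set α) : ℝ :=
  cov[E.indicator (fun _ => 1), F.indicator (fun _ => 1); μ]

theorem memLp_indicator_one (hE : MeasurableSet E) :
    MemLp (E.indicator (fun _ => (1 : ℝ))) 2 μ :=
  memLp_indicator_const 2 hE 1 (Or.inr (measure_ne_top μ E))

theorem eventCov_eq (hE : MeasurableSet E) (hF : MeasurableSet F) :
    eventCov μ E F = μ.real (E ∩ F) - μ.real E * μ.real F := by
  rw [eventCov, covariance_eq_sub (memLp_indicator_one hE) (memLp_indicator_one hF)]
  have h : E.indicator (fun _ => (1 : ℝ)) * F.indicator (fun _ => 1) =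
      (E ∩ F).indicator (fun _ => 1) := by
    ext a
    simp [Set.inter_indicator_mul (fun _ : α => (1 : ℝ)) (fun _ => 1) a |>.symm]
  rw [h, integral_indicator_const _ hE, integral_indicator_const _ hF,
    integral_indicator_const _ (hE.inter hF)]
  simp

theorem abs_eventCov_le_left (hE : MeasurableSet E) (hF : MeasurableSet F) :
    |eventCov μ E F| ≤ μ.real E := by
  rw [eventCov_eq hE hF]
  have h1 : μ.real (E ∩ F) ≤ μ.real E := measureReal_mono Set.inter_subset_left
  have h2 : μ.real E * μ.real F ≤ μ.real E := mul_le_of_le_one_right measureReal_nonneg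
    measureReal_le_one
  have h3 : 0 ≤ μ.real E * μ.real F := by positivity
  have h4 : 0 ≤ μ.real (E ∩ F) := measureReal_nonneg
  exact abs_sub_le_iff.mpr ⟨by linarith, by linarith⟩

theorem eventCov_compl_left (hE : MeasurableSet E) (hF : MeasurableSet F) :
    eventCov μ Eᶜ F = - eventCov μ E F := by
  rw [eventCov_eq hE hF, eventCov_eq hE.compl hF, probReal_compl_eq_one_sub hE]
  have := measureReal_inter_add_sdiff (μ := μ) (s := F) hE
  rw [Set.sdiff_eq, Set.inter_comm, Set.inter_comm F] at this
  linarith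

theorem abs_eventCov_le_compl_left (hE : MeasurableSet E) (hF : MeasurableSet F) :
    |eventCov μ E F| ≤ μ.real Eᶜ := by
  rw [← abs_neg, ← eventCov_compl_left hE hF]
  exact abs_eventCov_le_left hE.compl hF

theorem measureReal_sub_le_symmDiff (E E' : Set α) :
    μ.real E - μ.real E' ≤ μ.real (symmDiff E E') := by
  have h : E ⊆ E' ∪ symmDiff E E' := fun a ha => by
    by_cases h' : a ∈ E'
    · exact Or.inl h'
    · exact Or.inr (Or.inl ⟨ha, h'⟩)
  have := (measureReal_mono (μ := μ) h).trans (measureReal_union_le _ _)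
  linarith

/-- Each symmetric difference is paid twice: once in the probability of the intersection, once in
the product of probabilities. -/
theorem eventCov_sub_le (hE : MeasurableSet E) (hF : MeasurableSet F) (hE' : MeasurableSet E')
    (hF' : MeasurableSet F') : eventCov μ E F - eventCov μ E' F' ≤
      2 * μ.real (symmDiff E E') + 2 * μ.real (symmDiff F F') := by
  rw [eventCov_eq hE hF, eventCov_eq hE' hF']
  have h1 := measureReal_sub_le_symmDiff (μ := μ) (E ∩ F) (E' ∩ F')
  have h2 : μ.real (symmDiff (E ∩ F) (E' ∩ F')) ≤ μ.real (symmDiff E E') + μ.real (symmDiff F F') := by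
    refine (measureReal_mono ?_).trans (measureReal_union_le _ _)
    intro a ha
    simp only [Set.mem_symmDiff, Set.mem_inter_iff, Set.mem_union] at ha ⊢
    tauto
  have h3 := measureReal_sub_le_symmDiff (μ := μ) E' E
  have h4 := measureReal_sub_le_symmDiff (μ := μ) F' F
  rw [symmDiff_comm] at h3 h4
  have e1 : μ.real F ≤ 1 := measureReal_le_one
  have e2 : μ.real E' ≤ 1 := measureReal_le_one
  have e3 : 0 ≤ μ.real F := measureReal_nonneg
  have e4 : 0 ≤ μ.real E' := measureReal_nonneg
  have e5 : 0 ≤ μ.real (symmDiff E E') := measureReal_nonneg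
  have e6 : 0 ≤ μ.real (symmDiff F F') := measureReal_nonneg
  nlinarith [mul_le_mul_of_nonneg_right h3 e3, mul_le_mul_of_nonneg_left h4 e4,
    mul_le_mul_of_nonneg_left e1 e5, mul_le_mul_of_nonneg_left e2 e6]

theorem abs_eventCov_le_add (hE : MeasurableSet E) (hF : MeasurableSet F)
    (hE' : MeasurableSet E') (hF' : MeasurableSet F') : |eventCov μ E F| ≤
      |eventCov μ E' F'| + (2 * μ.real (symmDiff E E') + 2 * μ.real (symmDiff F F')) := by
  have h1 := eventCov_sub_le (μ := μ) hE hF hE' hF'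
  have h2 := eventCov_sub_le (μ := μ) hE' hF' hE hF
  rw [symmDiff_comm E', symmDiff_comm F'] at h2
  have h3 := abs_sub_abs_le_abs_sub (eventCov μ E F) (eventCov μ E' F')
  have h4 := abs_sub_le_iff.mpr ⟨h1, h2⟩
  linarith

/-- A sum of indicators with summable covariances is square integrable, and its variance is at most
the sum of the absolute values of the covariances. -/
theorem memLp_and_variance_le_of_tsum_eventCov {ι : Type*} [Countable ι] {E : ι → Set α}
    (hE : ∀ i, MeasurableSet (E i)) {X : α → ℝ}
    (hX : ∀ a, HasSum (fun i => (E i).indicator (fun _ => (1 : ℝ)) a) (X a))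
    (hmean : ∑' i, μ (E i) ≠ ∞) {S : ℝ} (hS : 0 ≤ S)
    (hcov : ∑' i, ∑' j, ENNReal.ofReal |eventCov μ (E i) (E j)| ≤ ENNReal.ofReal S) :
    MemLp X 2 μ ∧ Var[X; μ] ≤ S := by
  let f : ι → α → ℝ := fun i => (E i).indicator fun _ => 1
  have hf0 : ∀ i a, 0 ≤ f i a := fun i a => Set.indicator_nonneg (fun _ _ => zero_le_one) a
  let Y : Finset ι → α → ℝ := fun s a => ∑ i ∈ s, f i a
  have hfL : ∀ i, MemLp (f i) 2 μ := fun i => memLp_indicator_one (hE i)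
  have hYL : ∀ s, MemLp (Y s) 2 μ := fun s => memLp_finsetSum s fun i _ => hfL i
  have hY0 : ∀ s a, 0 ≤ Y s a := fun s a => Finset.sum_nonneg fun i _ => hf0 i a
  have hYX : ∀ s a, Y s a ≤ X a := fun s a => sum_le_hasSum s (fun i _ => hf0 i a) (hX a)
  have hvar : ∀ s, Var[Y s; μ] ≤ S := by
    intro s
    have h1 : Var[Y s; μ] = ∑ i ∈ s, ∑ j ∈ s, eventCov μ (E i) (E j) :=
      variance_fun_sum' fun i _ => hfL i
    rw [h1, ← ENNReal.ofReal_le_ofReal_iff hS]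
    refine le_trans ?_ hcov
    calc ENNReal.ofReal (∑ i ∈ s, ∑ j ∈ s, eventCov μ (E i) (E j))
        ≤ ENNReal.ofReal (∑ i ∈ s, ∑ j ∈ s, |eventCov μ (E i) (E j)|) :=
          ENNReal.ofReal_le_ofReal (Finset.sum_le_sum fun i _ => Finset.sum_le_sum fun j _ =>
            le_abs_self _)
      _ = ∑ i ∈ s, ∑ j ∈ s, ENNReal.ofReal |eventCov μ (E i) (E j)| := by
          rw [ENNReal.ofReal_sum_of_nonneg fun i _ => Finset.sum_nonneg fun j _ => abs_nonneg _]
          exact Finset.sum_congr rfl fun i _ =>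
            ENNReal.ofReal_sum_of_nonneg fun j _ => abs_nonneg _
      _ ≤ ∑ i ∈ s, ∑' j, ENNReal.ofReal |eventCov μ (E i) (E j)| :=
          Finset.sum_le_sum fun i _ => ENNReal.sum_le_tsum s
      _ ≤ _ := ENNReal.sum_le_tsum s
  have hexp : ∀ s, ∫ a, Y s a ∂μ ≤ (∑' i, μ (E i)).toReal := by
    intro s
    rw [integral_finsetSum s fun i _ => (hfL i).integrable one_le_two]
    have : ∀ i, ∫ a, f i a ∂μ = μ.real (E i) := fun i => by
      simp [f, integral_indicator_const _ (hE i)]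
    simp only [this, measureReal_def]
    rw [← ENNReal.toReal_sum fun i _ => measure_ne_top μ _]
    exact ENNReal.toReal_mono hmean (ENNReal.sum_le_tsum s)
  have hsq : ∀ s, ∫ a, Y s a ^ 2 ∂μ ≤ S + (∑' i, μ (E i)).toReal ^ 2 := by
    intro s
    have h1 := variance_eq_sub (hYL s)
    have h2 := pow_le_pow_left₀ (integral_nonneg (hY0 s)) (hexp s) 2
    have h3 : ∫ a, Y s a ^ 2 ∂μ = μ[Y s ^ 2] := rfl
    linarith [hvar s]
  -- Countability of `ι` gives a sequence of finite index sets along which Fatou's lemma makes `X`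
  -- square integrable. Since `X` dominates the partial sums, first and second moments then
  -- converge, and the variance bound passes to the limit.
  obtain ⟨u, hu⟩ := exists_seq_tendsto (atTop : Filter (Finset ι))
  have hlim : ∀ a, Tendsto (fun n => Y (u n) a) atTop (𝓝 (X a)) := fun a => (hX a).comp hu
  have hXm : AEStronglyMeasurable X μ := aestronglyMeasurable_of_tendsto_ae atTop
    (fun n => (hYL (u n)).aestronglyMeasurable) (Eventually.of_forall hlim)
  have hXint : Integrable (fun a => X a ^ 2) μ := by
    refine ⟨hXm.pow 2, ?_⟩
    rw [hasFiniteIntegral_iff_ofReal (Eventually.of_forall fun a => sq_nonneg _)]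
    have h1 : ∀ a, ENNReal.ofReal (X a ^ 2) =
        liminf (fun n => ENNReal.ofReal (Y (u n) a ^ 2)) atTop := fun a =>
      (((ENNReal.continuous_ofReal.tendsto _).comp ((hlim a).pow 2)).liminf_eq).symm
    simp only [h1]
    refine (lintegral_liminf_le' fun n => ?_).trans_lt ?_
    · exact ((hYL (u n)).aestronglyMeasurable.aemeasurable.pow_const 2).ennreal_ofReal
    · refine lt_of_le_of_lt (b := ENNReal.ofReal (S + (∑' i, μ (E i)).toReal ^ 2)) ?_
        ENNReal.ofReal_lt_top
      refine liminf_le_of_le (by isBoundedDefault) fun b hb => ?_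
      obtain ⟨n, hn⟩ := hb.exists
      refine hn.trans ?_
      rw [← ofReal_integral_eq_lintegral_ofReal (hYL (u n)).integrable_sq
        (Eventually.of_forall fun a => sq_nonneg _)]
      exact ENNReal.ofReal_le_ofReal (hsq _)
  have hXL : MemLp X 2 μ := (memLp_two_iff_integrable_sq hXm).mpr hXint
  refine ⟨hXL, ?_⟩
  have hX1 : Tendsto (fun n => ∫ a, Y (u n) a ∂μ) atTop (𝓝 (∫ a, X a ∂μ)) := by
    refine tendsto_integral_of_dominated_convergence X
      (fun n => (hYL (u n)).aestronglyMeasurable) (hXL.integrable one_le_two)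
      (fun n => Eventually.of_forall fun a => ?_) (Eventually.of_forall hlim)
    rw [Real.norm_of_nonneg (hY0 _ a)]
    exact hYX _ a
  have hX2 : Tendsto (fun n => ∫ a, Y (u n) a ^ 2 ∂μ) atTop (𝓝 (∫ a, X a ^ 2 ∂μ)) := by
    refine tendsto_integral_of_dominated_convergence (fun a => X a ^ 2)
      (fun n => (hYL (u n)).aestronglyMeasurable.pow 2) hXint
      (fun n => Eventually.of_forall fun a => ?_) (Eventually.of_forall fun a => (hlim a).pow 2)
    rw [Real.norm_of_nonneg (sq_nonneg _)]
    exact pow_le_pow_left₀ (hY0 _ a) (hYX _ a) 2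
  have hV : Tendsto (fun n => Var[Y (u n); μ]) atTop (𝓝 Var[X; μ]) := by
    rw [variance_eq_sub hXL]
    simp only [variance_eq_sub (hYL _)]
    exact hX2.sub (hX1.pow 2)
  exact le_of_tendsto' hV fun n => hvar _

end EventCovariance

/-! ### Frontiers, thickenings and dilations -/

section Frontier

variable {d : ℕ}

/-- If `x` lies in a set and `y` does not, the distance from `x` to the complement is attained on
the frontier; apply this to `A` or to its complement. -/
theorem exists_mem_frontier_dist_le {A : Set (Space d)} {x y : Space d} (h : ¬ (x ∈ A ↔ y ∈ A)) :
    ∃ z ∈ frontier A, dist x z ≤ dist x y := by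
  have key : ∀ B : Set (Space d), x ∈ B → y ∉ B → ∃ z ∈ frontier B, dist x z ≤ dist x y := by
    intro B hx hy
    obtain ⟨z, hz, hzx⟩ := exists_mem_frontier_infDist_compl_eq_dist hx
      (fun h : B = Set.univ => hy (h ▸ Set.mem_univ y))
    exact ⟨z, hz, hzx ▸ Metric.infDist_le_dist_of_mem hy⟩
  by_cases hx : x ∈ A
  · exact key A hx (by tauto)
  · rw [← frontier_compl]
    exact key Aᶜ hx (by rw [Set.mem_compl_iff]; tauto)

theorem frontier_smul_of_ne_zero {r : ℝ} (hr : r ≠ 0) (A : Set (Space d)) :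
    frontier (r • A) = r • frontier A :=
  ((Homeomorph.smulOfNeZero (α := Space d) r hr).image_frontier A).symm

theorem volume_smul {r : ℝ} (hr : 0 ≤ r) (A : Set (Space d)) :
    volume (r • A) = ENNReal.ofReal (r ^ d) * volume A := by
  rw [Measure.addHaar_smul, finrank_euclideanSpace_fin, abs_of_nonneg (pow_nonneg hr d)]

theorem volume_cthickening_smul_le {r s : ℝ} (hr : 0 < r) (A : Set (Space d)) :
    volume (Metric.cthickening s (r • A)) ≤
      ENNReal.ofReal (r ^ d) * volume (Metric.cthickening (s / r) A) := by
  rw [← volume_smul hr.le]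
  refine measure_mono fun x hx => ?_
  refine ⟨r⁻¹ • x, ?_, smul_inv_smul₀ hr.ne' x⟩
  rw [Metric.mem_cthickening_iff] at hx ⊢
  have h1 := infEDist_smul₀ (inv_ne_zero hr.ne') (r • A) x
  rw [inv_smul_smul₀ hr.ne'] at h1
  rw [h1, ENNReal.smul_def, smul_eq_mul, div_eq_inv_mul, ENNReal.ofReal_mul (by positivity)]
  gcongr
  rw [← ENNReal.ofReal_coe_nnreal, coe_nnnorm, Real.norm_of_nonneg (by positivity)]

end Frontier

/-! ### Two bounds for the covariance sums -/

section CovarianceSums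

variable {d : ℕ} {μ : Measure (Config d)}

/-- The sum over all pairs of lattice points with difference `w` of the absolute covariances of the
events that their partners belong to `A`. -/
noncomputable def covSum (μ : Measure (Config d)) (A : Set (Space d)) (w : Fin d → ℤ) : ℝ≥0∞ :=
  ∑' p, ENNReal.ofReal |eventCov μ (hitEvent Partner p A) (hitEvent Partner (p + w) A)|

variable [IsProbabilityMeasure μ]
  (hμ : ∀ v : Fin d → ℤ, μ.map (fun φ => φ.shift (latticePoint v)) = μ)

include hμ in
theorem tsum_measure_hitEvent_partner_le {A : Set (Space d)} {L : ℝ}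
    (hAL : A ⊆ Metric.closedBall 0 L) :
    ∑' p, μ (hitEvent Partner p A) ≤ (latticeBall d (L + d)).card :=
  (isTransport_partner.tsum_measure_hitEvent_le hμ (subset_biUnion_cell hAL)).trans
    (mul_le_of_le_one_right' prob_le_one)

include hμ in
-- A crude bound, of the right order in `L`, for the finitely many `w` to which the mixing argument
-- does not apply.
theorem covSum_le_card {A : Set (Space d)} (hA : MeasurableSet A) {L : ℝ}
    (hAL : A ⊆ Metric.closedBall 0 L) (w : Fin d → ℤ) :
    covSum μ A w ≤ (latticeBall d (L + d)).card := by
  refine (ENNReal.tsum_le_tsum fun p => ?_).trans (tsum_measure_hitEvent_partner_le hμ hAL)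
  rw [← ofReal_measureReal (μ := μ)]
  exact ENNReal.ofReal_le_ofReal (abs_eventCov_le_left
    (isTransport_partner.measurableSet_hitEvent _ hA)
    (isTransport_partner.measurableSet_hitEvent _ hA))

theorem symmDiff_hitEvent_subset (T T' : Config d → (Fin d → ℤ) → Space d → Prop)
    (p : Fin d → ℤ) (A : Set (Space d)) :
    symmDiff (hitEvent T p A) (hitEvent T' p A) ⊆
      hitEvent (fun φ w x => T φ w x ∧ ¬ T' φ w x) p A ∪
        hitEvent (fun φ w x => T' φ w x ∧ ¬ T φ w x) p A := by
  rintro φ (⟨⟨x, hx, hT⟩, h⟩ | ⟨⟨x, hx, hT⟩, h⟩)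
  · exact Or.inl ⟨x, hx, hT, fun h' => h ⟨x, hx, h'⟩⟩
  · exact Or.inr ⟨x, hx, hT, fun h' => h ⟨x, hx, h'⟩⟩

theorem hitEvent_localPartner_eq_empty {A : Set (Space d)} {L ρ : ℝ}
    (hAL : A ⊆ Metric.closedBall 0 L) {p : Fin d → ℤ} (hp : p ∉ latticeBall d (L + ρ)) :
    hitEvent (LocalPartner ρ) p A = ∅ := by
  refine Set.eq_empty_of_forall_notMem ?_
  rintro φ ⟨x, hx, hT⟩
  refine hp (mem_latticeBall.mpr ?_)
  have h1 : dist x (latticePoint p) ≤ ρ := (Matched.snd_mem hT).2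
  have h2 : ‖x‖ ≤ L := by simpa using hAL hx
  have h3 := norm_sub_le x (x - latticePoint p)
  rw [sub_sub_cancel, ← dist_eq_norm] at h3
  linarith

include hμ in
/-- Approximation of the partners by local partners, the covariances of which are at most `a`. -/
theorem covSum_le_of_local {A : Set (Space d)} (hA : MeasurableSet A) {L : ℝ}
    (hAL : A ⊆ Metric.closedBall 0 L) {w : Fin d → ℤ} {ρ a : ℝ} {ε : ℝ≥0∞}
    (ha : ∀ p, |eventCov μ (hitEvent (LocalPartner ρ) p A)
      (hitEvent (LocalPartner ρ) (p + w) A)| ≤ a)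
    (h₁ : μ (hitEvent (fun φ w x => Partner φ w x ∧ ¬ LocalPartner ρ φ w x) 0 Set.univ) ≤ ε)
    (h₂ : μ (hitEvent (fun φ w x => LocalPartner ρ φ w x ∧ ¬ Partner φ w x) 0 Set.univ) ≤ ε) :
    covSum μ A w ≤ (latticeBall d (L + ρ)).card * ENNReal.ofReal a +
      8 * ((latticeBall d (L + d)).card * ε) := by
  classical
  have hT := isTransport_partner (d := d)
  have hT' := isTransport_localPartner (d := d) ρ
  -- The two terms are the two ways the choices can disagree. The final 8 is a factor 2 for these, 2
  -- for the points `p` and `p + w`, and 2 from `abs_eventCov_le_add`.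
  let m : (Fin d → ℤ) → ℝ≥0∞ := fun p =>
    μ (hitEvent (fun φ w x => Partner φ w x ∧ ¬ LocalPartner ρ φ w x) p A) +
      μ (hitEvent (fun φ w x => LocalPartner ρ φ w x ∧ ¬ Partner φ w x) p A)
  have hD : ∀ p, ENNReal.ofReal (2 * μ.real
      (symmDiff (hitEvent Partner p A) (hitEvent (LocalPartner ρ) p A))) ≤ 2 * m p := by
    intro p
    rw [ENNReal.ofReal_mul zero_le_two, ofReal_measureReal, ENNReal.ofReal_ofNat]
    gcongr
    exact (measure_mono (symmDiff_hitEvent_subset _ _ p A)).trans (measure_union_le _ _)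
  have hpt : ∀ p, ENNReal.ofReal
      |eventCov μ (hitEvent Partner p A) (hitEvent Partner (p + w) A)| ≤
      (if p ∈ latticeBall d (L + ρ) then ENNReal.ofReal a else 0) +
        (2 * m p + 2 * m (p + w)) := by
    intro p
    refine (ENNReal.ofReal_le_ofReal (abs_eventCov_le_add (hT.measurableSet_hitEvent _ hA)
      (hT.measurableSet_hitEvent _ hA) (hT'.measurableSet_hitEvent p hA)
      (hT'.measurableSet_hitEvent (p + w) hA))).trans ?_
    rw [ENNReal.ofReal_add (abs_nonneg _) (by positivity),
      ENNReal.ofReal_add (by positivity) (by positivity)]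
    refine add_le_add ?_ (add_le_add (hD p) (hD (p + w)))
    split_ifs with hp
    · exact ENNReal.ofReal_le_ofReal (ha p)
    · refine (ENNReal.ofReal_le_ofReal (abs_eventCov_le_left (hT'.measurableSet_hitEvent _ hA)
        (hT'.measurableSet_hitEvent _ hA))).trans ?_
      simp [hitEvent_localPartner_eq_empty hAL hp]
  have hm : ∑' p, m p ≤ 2 * ((latticeBall d (L + d)).card * ε) := by
    rw [ENNReal.tsum_add, two_mul]
    refine add_le_add ?_ ?_
    · exact ((hT.and_not hT').tsum_measure_hitEvent_le hμ (subset_biUnion_cell hAL)).trans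
        (by gcongr)
    · exact ((hT'.and_not hT).tsum_measure_hitEvent_le hμ (subset_biUnion_cell hAL)).trans
        (by gcongr)
  have hmw : ∑' p, m (p + w) = ∑' p, m p := (Equiv.addRight w).tsum_eq m
  calc covSum μ A w ≤ ∑' p, ((if p ∈ latticeBall d (L + ρ) then ENNReal.ofReal a else 0) +
        (2 * m p + 2 * m (p + w))) := ENNReal.tsum_le_tsum hpt
    _ = (latticeBall d (L + ρ)).card * ENNReal.ofReal a + 4 * ∑' p, m p := by
        rw [ENNReal.tsum_add, ENNReal.tsum_add, ENNReal.tsum_mul_left, ENNReal.tsum_mul_left, hmw,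
          ← add_mul, tsum_eq_sum (s := latticeBall d (L + ρ)) fun p hp => if_neg hp,
          Finset.sum_congr rfl fun p hp => if_pos hp, Finset.sum_const, nsmul_eq_mul]
        norm_num
    _ ≤ _ := by
        refine add_le_add le_rfl ?_
        calc 4 * ∑' p, m p ≤ 4 * (2 * ((latticeBall d (L + d)).card * ε)) := by gcongr
          _ = _ := by rw [← mul_assoc]; norm_num

include hμ in
/-- A bound for the covariances in terms of the lattice points near the boundary of `A` and the
probability that a partner is at distance more than `R`. -/
theorem covSum_le_frontier {A : Set (Space d)} (hA : MeasurableSet A) {L : ℝ}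
    (hAL : A ⊆ Metric.closedBall 0 L) (w : Fin d → ℤ) {R : ℝ} :
    covSum μ A w ≤ volume (Metric.cthickening d (Metric.cthickening R (frontier A))) +
      2 * ((latticeBall d (L + d)).card *
        μ (hitEvent Partner 0 (Metric.closedBall 0 R))ᶜ) := by
  classical
  have hT := isTransport_partner (d := d)
  set δ := μ (hitEvent (Partner (d := d)) 0 (Metric.closedBall 0 R))ᶜ with hδ
  have hbd : Bornology.IsBounded (Metric.cthickening R (frontier A)) :=
    (((Metric.isBounded_closedBall (x := (0 : Space d)) (r := L)).subset hAL).closure.subset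
      frontier_subset_closure).cthickening
  set Z := (finite_latticePoint_mem hbd).toFinset with hZdef
  have hZ : ∀ z, z ∈ Z ↔ latticePoint z ∈ Metric.cthickening R (frontier A) := fun z => by
    simp [hZdef]
  let far : Config d → (Fin d → ℤ) → Space d → Prop :=
    fun φ w x => Partner φ w x ∧ R < dist x (latticePoint w)
  have hfar : IsTransport far := hT.and_lt_dist R
  have hpt : ∀ p, ENNReal.ofReal
      |eventCov μ (hitEvent Partner p A) (hitEvent Partner (p + w) A)| ≤
      (if p ∈ Z then 1 else 0) + ((if p ∈ latticeBall d (L + d) then δ else 0) +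
        μ (hitEvent far p A)) := by
    intro p
    have hE := hT.measurableSet_hitEvent p hA
    have hF := hT.measurableSet_hitEvent (p + w) hA
    by_cases hpZ : p ∈ Z
    · rw [if_pos hpZ]
      refine le_trans ?_ le_self_add
      rw [ENNReal.ofReal_le_one]
      exact (abs_eventCov_le_left hE hF).trans measureReal_le_one
    have hnear : ∀ x, dist x (latticePoint p) ≤ R → (latticePoint p ∈ A ↔ x ∈ A) := by
      intro x hx
      by_contra hcon
      obtain ⟨z, hz, hzp⟩ := exists_mem_frontier_dist_le hcon
      rw [dist_comm] at hx
      exact hpZ ((hZ p).mpr (Metric.mem_cthickening_of_dist_le _ z _ _ hz (hzp.trans hx)))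
    rw [if_neg hpZ, zero_add]
    -- Away from the frontier the `R`-ball around `p` lies on one side of `A`. Inside, the
    -- complement of the first event has probability at most `δ`; outside, the event forces a
    -- partner at distance more than `R`, and mass transport sums these. The second event plays no
    -- role, so the bound does not depend on `w`.
    by_cases hpA : latticePoint p ∈ A
    · have hpL : p ∈ latticeBall d (L + d) := by
        have : ‖latticePoint p‖ ≤ L := by simpa using hAL hpA
        exact mem_latticeBall.mpr (by linarith [(Nat.cast_nonneg d : (0 : ℝ) ≤ d)])
      rw [if_pos hpL]
      refine le_trans ?_ le_self_add
      refine (ENNReal.ofReal_le_ofReal (abs_eventCov_le_compl_left hE hF)).trans ?_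
      rw [ofReal_measureReal]
      have hsub : Metric.closedBall (latticePoint p) R ⊆ A := fun x hx => (hnear x hx).mp hpA
      refine (measure_mono (Set.compl_subset_compl.mpr (hitEvent_mono hsub))).trans_eq ?_
      rw [hδ, prob_compl_eq_one_sub (hT.measurableSet_hitEvent _ measurableSet_closedBall),
        prob_compl_eq_one_sub (hT.measurableSet_hitEvent _ measurableSet_closedBall),
        hT.measure_hitEvent hμ p measurableSet_closedBall]
      simp
    · refine le_trans ?_ le_add_self
      refine (ENNReal.ofReal_le_ofReal (abs_eventCov_le_left hE hF)).trans ?_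
      rw [ofReal_measureReal]
      refine measure_mono ?_
      rintro φ ⟨x, hx, hxT⟩
      refine ⟨x, hx, hxT, ?_⟩
      by_contra! hR
      exact hpA ((hnear x hR).mpr hx)
  have hfarδ : μ (hitEvent far 0 Set.univ) ≤ δ := by
    refine measure_mono ?_
    rintro φ ⟨x, -, hxT, hxR⟩ ⟨y, hy, hyT⟩
    rw [hT.unique hyT hxT] at hy
    rw [latticePoint_zero] at hxR
    exact absurd hy (by rw [Metric.mem_closedBall]; exact hxR.not_ge)
  calc covSum μ A w ≤ ∑' p, ((if p ∈ Z then 1 else 0) +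
        ((if p ∈ latticeBall d (L + d) then δ else 0) + μ (hitEvent far p A))) :=
        ENNReal.tsum_le_tsum hpt
    _ = Z.card + ((latticeBall d (L + d)).card * δ + ∑' p, μ (hitEvent far p A)) := by
        rw [ENNReal.tsum_add, ENNReal.tsum_add, tsum_eq_sum (s := Z) fun p hp => if_neg hp,
          Finset.sum_congr rfl fun p hp => if_pos hp,
          tsum_eq_sum (s := latticeBall d (L + d)) fun p hp => if_neg hp,
          Finset.sum_congr rfl fun p hp => if_pos hp, Finset.sum_const, nsmul_eq_mul,
          Finset.sum_const, nsmul_eq_mul, mul_one]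
    _ ≤ _ := by
        rw [two_mul]
        gcongr
        · exact card_le_volume_cthickening fun z hz => (hZ z).mp hz
        · exact (hfar.tsum_measure_hitEvent_le hμ (subset_biUnion_cell hAL)).trans (by gcongr)

end CovarianceSums

/-! ### Mixing bound for local partners -/

section Mixing

variable {d : ℕ} {Ω : Type*} [MeasurableSpace Ω] {P : Measure Ω} [IsProbabilityMeasure P]
  {Ψ : Ω → Config d}

theorem abs_cov_le_one_of_zero_or_one {f g : Ω → ℝ} (hf : Measurable f) (hg : Measurable g)
    (hf01 : ∀ ω, f ω = 0 ∨ f ω = 1) (hg01 : ∀ ω, g ω = 0 ∨ g ω = 1) : |cov[f, g; P]| ≤ 1 := by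
  have key : ∀ h : Ω → ℝ, (∀ ω, h ω = 0 ∨ h ω = 1) → h = (h ⁻¹' {1}).indicator fun _ => 1 := by
    intro h hh
    funext ω
    rcases hh ω with h0 | h1
    · simp [Set.indicator, h0]
    · simp [Set.indicator, h1]
  rw [key f hf01, key g hg01]
  exact (abs_eventCov_le_left (hf (measurableSet_singleton 1))
    (hg (measurableSet_singleton 1))).trans measureReal_le_one

theorem le_mixingCoeff (hΨ : Measurable Ψ) {m s : ℝ} {f g : Config d → ℝ} {A B : Set (Space d)}
    (hf : Measurable f) (hg : Measurable g) (hf01 : ∀ φ, f φ = 0 ∨ f φ = 1)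
    (hg01 : ∀ φ, g φ = 0 ∨ g φ = 1) (hA : MeasurableSet A) (hB : MeasurableSet B)
    (hAm : volume A ≤ ENNReal.ofReal m) (hBm : volume B ≤ ENNReal.ofReal m)
    (hAB : ∀ x ∈ A, ∀ y ∈ B, s ≤ dist x y) :
    |cov[fun ω => f ((Ψ ω).restrict A), fun ω => g ((Ψ ω).restrict B); P]| ≤
      mixingCoeff Ψ P m m s := by
  refine le_csSup ⟨1, ?_⟩ ⟨f, g, A, B, hf, hg, hf01, hg01, hA, hB, hAm, hBm, hAB, rfl⟩
  rintro c ⟨f, g, A, B, hf, hg, hf01, hg01, hA, hB, -, -, -, rfl⟩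
  exact abs_cov_le_one_of_zero_or_one (hf.comp ((Config.measurable_restrict hA).comp hΨ))
    (hg.comp ((Config.measurable_restrict hB).comp hΨ)) (fun _ => hf01 _) fun _ => hg01 _

omit [IsProbabilityMeasure P] in
theorem mixingCoeff_nonneg (m s : ℝ) : 0 ≤ mixingCoeff Ψ P m m s := by
  refine Real.sSup_nonneg ?_
  rintro c ⟨f, g, A, B, -, -, -, -, -, -, -, -, -, rfl⟩
  exact abs_nonneg _

theorem abs_eventCov_localPartner_le_mixingCoeff (hΨ : Measurable Ψ) {A : Set (Space d)}
    (hA : MeasurableSet A) {ρ m s : ℝ} {w : Fin d → ℤ}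
    (hvol : volume (Metric.closedBall (0 : Space d) ρ) ≤ ENNReal.ofReal m)
    (hs : s + 2 * ρ ≤ ‖latticePoint w‖) (p : Fin d → ℤ) :
    |eventCov (P.map Ψ) (hitEvent (LocalPartner ρ) p A)
      (hitEvent (LocalPartner ρ) (p + w) A)| ≤ mixingCoeff Ψ P m m s := by
  have hT := isTransport_partner (d := d)
  have hT' := isTransport_localPartner (d := d) ρ
  have hind : ∀ {E : Set (Config d)}, MeasurableSet E →
      Measurable (E.indicator fun _ => (1 : ℝ)) := fun hE => measurable_const.indicator hE
  have h01 : ∀ (E : Set (Config d)) φ, E.indicator (fun _ => (1 : ℝ)) φ = 0 ∨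
      E.indicator (fun _ => (1 : ℝ)) φ = 1 := fun E φ => Set.indicator_eq_zero_or_self E _ φ
  have hv : ∀ q : Fin d → ℤ, volume (Metric.closedBall (latticePoint q) ρ) ≤ ENNReal.ofReal m :=
    fun q => (Measure.addHaar_closedBall_center volume _ ρ).trans_le hvol
  rw [eventCov, covariance_map
    (hind (hT'.measurableSet_hitEvent p hA)).aestronglyMeasurable
    (hind (hT'.measurableSet_hitEvent (p + w) hA)).aestronglyMeasurable hΨ.aemeasurable]
  -- By definition, the local event at `Ψ ω` is the `Partner` event evaluated at the restriction of
  -- `Ψ ω` to the ball, so its indicator has the form required by the mixing coefficient.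
  refine le_mixingCoeff hΨ (hind (hT.measurableSet_hitEvent p hA))
    (hind (hT.measurableSet_hitEvent (p + w) hA)) (h01 _) (h01 _)
    (measurableSet_closedBall (x := latticePoint p) (ε := ρ))
    (measurableSet_closedBall (x := latticePoint (p + w)) (ε := ρ)) (hv _) (hv _) ?_
  intro x hx y hy
  have h1 : ‖latticePoint w‖ = dist (latticePoint p) (latticePoint (p + w)) := by
    rw [latticePoint_add, dist_self_add_right]
  have h2 := dist_triangle4 (latticePoint p) x y (latticePoint (p + w))
  rw [Metric.mem_closedBall, dist_comm] at hx
  rw [Metric.mem_closedBall] at hy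
  linarith

end Mixing

/-! ### Rescaling the summation index -/

section FloorDivision

variable {d : ℕ}

/-- Coordinatewise integer division by `k`. -/
def floorDiv (k : ℕ) (w : Fin d → ℤ) : Fin d → ℤ := fun i => w i / (k : ℤ)

theorem abs_norm_floorDiv_sub_le (k : ℕ) (w : Fin d → ℤ) :
    |‖latticePoint w‖ / k - ‖latticePoint (floorDiv k w)‖| ≤ d := by
  have hmem : (k : ℝ)⁻¹ • latticePoint w ∈ cell (floorDiv k w) := by
    intro i
    have : ((k : ℝ)⁻¹ • latticePoint w) i = (w i : ℝ) / (k : ℝ) := by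
      simp [latticePoint, div_eq_inv_mul]
    rw [this, Int.floor_div_natCast]
    simp [floorDiv]
  have h1 := dist_latticePoint_le_of_mem_cell hmem
  rw [dist_eq_norm] at h1
  refine le_trans ?_ ((abs_norm_sub_norm_le _ _).trans h1)
  rw [norm_smul, norm_inv, Real.norm_natCast, div_eq_inv_mul]

/-- Quotient and remainder identify the lattice with its product with a finite set, so every value
of `h` is repeated `k ^ d` times. This evaluates the hypotheses at smaller scales without any
monotonicity of their terms. -/
theorem summable_comp_floorDiv {k : ℕ} (hk : 0 < k) {h : (Fin d → ℤ) → ℝ} (hs : Summable h) :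
    Summable fun w => h (floorDiv k w) := by
  have : NeZero k := ⟨hk.ne'⟩
  let e : (Fin d → ℤ) ≃ (Fin d → ℤ) × (Fin d → Fin k) :=
    (Equiv.arrowCongr (Equiv.refl _) (Int.divModEquiv k)).trans (Equiv.arrowProdEquivProdArrow _ _ _)
  have h1 : Summable fun x : (Fin d → ℤ) × (Fin d → Fin k) => h x.1 := by
    have := summable_mul_of_summable_norm (g := fun _ : Fin d → Fin k => (1 : ℝ)) hs.norm
      (hasSum_fintype _).summable.norm
    simpa using this
  exact e.summable_iff.mpr h1

theorem exists_nat_le_half_rpow {s : ℝ} (hs : 0 < s) (κ : ℝ) :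
    ∃ k : ℕ, 6 ≤ k ∧ κ ≤ ((k : ℝ) / 2) ^ s := by
  have h1 : Tendsto (fun k : ℕ => ((k : ℝ) / 2) ^ s) atTop atTop :=
    (tendsto_rpow_atTop hs).comp (tendsto_natCast_atTop_atTop.atTop_div_const zero_lt_two)
  obtain ⟨k, hk, hk'⟩ := ((eventually_ge_atTop 6).and (h1.eventually_ge_atTop κ)).exists
  exact ⟨k, hk, hk'⟩

end FloorDivision

/-! ### A summable bound, uniform in the window -/

section Domination

variable {d : ℕ} {Ω : Type*} [MeasurableSpace Ω] {P : Measure Ω} [IsProbabilityMeasure P]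
  {Ψ : Ω → Config d}

omit [IsProbabilityMeasure P] in
theorem IsStationary.map_shift (hΨ : Measurable Ψ) (hstat : IsStationary Ψ P)
    (v : Fin d → ℤ) : (P.map Ψ).map (fun φ => φ.shift (latticePoint v)) = P.map Ψ := by
  rw [Measure.map_map (Config.measurable_shift _) hΨ]
  exact (hstat (latticePoint v)).map_eq

/-- Only monotonicity is used, so the flower event itself need not be shown measurable. -/
theorem map_le_of_flower (hΨ : Measurable Ψ) {E : Set (Config d)} (hE : MeasurableSet E) {ρ : ℝ}
    (h : ∀ φ ∈ E, ¬ flower (lattice d) φ 0 ⊆ Metric.closedBall 0 ρ) :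
    P.map Ψ E ≤ ENNReal.ofReal
      (P.real {ω | ¬ flower (lattice d) (Ψ ω) 0 ⊆ Metric.closedBall 0 ρ}) := by
  rw [Measure.map_apply hΨ hE, ofReal_measureReal]
  exact measure_mono fun ω hω => h _ hω

/-- Three scales are used: `w`, `v ≈ w / k` and `u ≈ v / k`. Local partners use radius `ρ = ‖u‖ ^
γ`, and mixing is applied at scale `v`. The step from `w` to `v` leaves room for the two balls, that
from `v` to `u` absorbs the volume of the unit ball. -/
theorem exists_summable_bound_covSum (hd : 1 ≤ d) (hΨ : Measurable Ψ)
    (hstat : IsStationary Ψ P) {γ : ℝ} (hγ0 : 0 < γ) (hγ1 : γ ≤ 1)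
    (hmix : Summable (fun w : Fin d → ℤ =>
      ‖latticePoint w‖ ^ (γ * d) *
        mixingCoeff Ψ P (‖latticePoint w‖ ^ (γ * d)) (‖latticePoint w‖ ^ (γ * d))
          ‖latticePoint w‖))
    (hflower : Summable (fun w : Fin d → ℤ =>
      P.real {ω | ¬ flower (lattice d) (Ψ ω) 0 ⊆
        Metric.closedBall 0 (‖latticePoint w‖ ^ γ)})) :
    ∃ b : (Fin d → ℤ) → ℝ, Summable b ∧ ∀ L : ℝ, 1 ≤ L → ∀ A, MeasurableSet A →
      A ⊆ Metric.closedBall 0 L → ∀ w, covSum (P.map Ψ) A w ≤ ENNReal.ofReal (L ^ d * b w) := by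
  classical
  have hprob : IsProbabilityMeasure (P.map Ψ) := Measure.isProbabilityMeasure_map hΨ.aemeasurable
  have hμ := hstat.map_shift hΨ
  have hdpos : (0 : ℝ) < d := by exact_mod_cast hd
  have hγd : 0 < γ * d := by positivity
  obtain ⟨K, hK, hcard⟩ := exists_card_latticeBall_le d
  obtain ⟨k, hk6, hk⟩ := exists_nat_le_half_rpow hγd
    (volume (Metric.closedBall (0 : Space d) 1)).toReal
  have hk0 : 0 < k := by lia
  have hk6' : (6 : ℝ) ≤ k := by exact_mod_cast hk6
  set a : (Fin d → ℤ) → ℝ := fun w => ‖latticePoint w‖ ^ (γ * d) *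
        mixingCoeff Ψ P (‖latticePoint w‖ ^ (γ * d)) (‖latticePoint w‖ ^ (γ * d))
          ‖latticePoint w‖ with ha
  set ε : (Fin d → ℤ) → ℝ := fun w => P.real {ω | ¬ flower (lattice d) (Ψ ω) 0 ⊆
        Metric.closedBall 0 (‖latticePoint w‖ ^ γ)} with hε
  have hε0 : ∀ w, 0 ≤ ε w := fun w => measureReal_nonneg
  have ha0 : ∀ w, 0 ≤ a w := fun w => mul_nonneg (by positivity) (mixingCoeff_nonneg _ _)
  have hnorm : ∀ w : Fin d → ℤ, ‖latticePoint w‖ ≤ k * (‖latticePoint (floorDiv k w)‖ + d) ∧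
      k * (‖latticePoint (floorDiv k w)‖ - d) ≤ ‖latticePoint w‖ := by
    intro w
    have h := abs_le.mp (abs_norm_floorDiv_sub_le k w)
    have hkR : (0 : ℝ) < k := by positivity
    constructor
    · rw [← div_le_iff₀' hkR]; linarith
    · rw [← le_div_iff₀' hkR]; linarith
  -- Outside this finite set the rounding error `d` is at most half of the norms, so division by `k`
  -- shrinks norms by at least `k / 2`, hence by at least 3 since `6 ≤ k`.
  have hexc : {w : Fin d → ℤ | ‖latticePoint (floorDiv k (floorDiv k w))‖ < 2 * d}.Finite := by
    refine (finite_latticePoint_mem (Metric.isBounded_closedBall (x := (0 : Space d))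
      (r := k * (k * (2 * d + d) + d)))).subset fun w hw => ?_
    rw [Set.mem_ofPred_eq] at hw
    have h1 := (hnorm w).1
    have h2 := (hnorm (floorDiv k w)).1
    simp only [Set.mem_ofPred_eq, mem_closedBall_zero_iff]
    refine h1.trans ?_
    gcongr
    refine h2.trans ?_
    gcongr
  set Z := hexc.toFinset with hZ
  refine ⟨fun w => K * 2 ^ d * a (floorDiv k w) +
    8 * (K * (1 + d) ^ d * ε (floorDiv k (floorDiv k w))) +
      (if w ∈ Z then K * (1 + d) ^ d else 0), ?_, ?_⟩
  · refine Summable.add (Summable.add ?_ ?_) ?_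
    · exact (summable_comp_floorDiv hk0 hmix).mul_left _
    · exact ((summable_comp_floorDiv hk0 (summable_comp_floorDiv hk0 hflower)).mul_left _).mul_left _
    · exact summable_of_ne_finset_zero (s := Z) fun w hw => if_neg hw
  intro L hL A hA hAL w
  have hcardd : ((latticeBall d (L + d)).card : ℝ) ≤ L ^ d * (K * (1 + d) ^ d) := by
    refine (hcard (L + d) (by linarith)).trans ?_
    calc K * (L + d) ^ d ≤ K * (L * (1 + d)) ^ d := by gcongr; nlinarith
      _ = _ := by rw [mul_pow]; ring
  set v := floorDiv k w with hv
  set u := floorDiv k v with hu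
  change _ ≤ ENNReal.ofReal (L ^ d * (K * 2 ^ d * a v + 8 * (K * (1 + d) ^ d * ε u) +
    (if w ∈ Z then K * (1 + d) ^ d else 0)))
  by_cases hw : w ∈ Z
  · refine (covSum_le_card hμ hA hAL w).trans ?_
    rw [if_pos hw, ← ENNReal.ofReal_natCast]
    refine ENNReal.ofReal_le_ofReal (hcardd.trans ?_)
    gcongr
    have := ha0 v
    have := hε0 u
    have : 0 ≤ K * 2 ^ d * a v + 8 * (K * (1 + d) ^ d * ε u) := by positivity
    linarith
  · rw [if_neg hw, add_zero]
    have hu2 : 2 * (d : ℝ) ≤ ‖latticePoint u‖ := by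
      by_contra! h
      exact hw (hexc.mem_toFinset.mpr h)
    have hd1 : (1 : ℝ) ≤ d := by exact_mod_cast hd
    have huv : (k : ℝ) / 2 * ‖latticePoint u‖ ≤ ‖latticePoint v‖ := by
      nlinarith [(hnorm v).2]
    have huv' : ‖latticePoint u‖ ≤ ‖latticePoint v‖ := by nlinarith
    have hvw : 3 * ‖latticePoint v‖ ≤ ‖latticePoint w‖ := by
      nlinarith [(hnorm w).2]
    set ρ := ‖latticePoint u‖ ^ γ with hρ
    have hu1 : 1 ≤ ‖latticePoint u‖ := by linarith
    have hρ1 : 1 ≤ ρ := Real.one_le_rpow hu1 hγ0.le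
    have hρu : ρ ≤ ‖latticePoint u‖ := by
      simpa using Real.rpow_le_rpow_of_exponent_le hu1 hγ1
    have hρd : ρ ^ d = ‖latticePoint u‖ ^ (γ * d) := by
      rw [hρ, ← Real.rpow_natCast, ← Real.rpow_mul (norm_nonneg _)]
    -- The choice of `k` makes `(k / 2) ^ (γ * d)` at least the volume of the unit ball.
    have hvol : volume (Metric.closedBall (0 : Space d) ρ) ≤
        ENNReal.ofReal (‖latticePoint v‖ ^ (γ * d)) := by
      rw [Measure.addHaar_closedBall' _ _ (by linarith), finrank_euclideanSpace_fin,
        ← ENNReal.ofReal_toReal (measure_closedBall_lt_top (μ := volume) (x := (0 : Space d))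
          (r := 1)).ne, ← ENNReal.ofReal_mul (by positivity), hρd]
      refine ENNReal.ofReal_le_ofReal ?_
      calc ‖latticePoint u‖ ^ (γ * d) * (volume (Metric.closedBall (0 : Space d) 1)).toReal
          ≤ ‖latticePoint u‖ ^ (γ * d) * ((k : ℝ) / 2) ^ (γ * d) := by gcongr
        _ = ((k : ℝ) / 2 * ‖latticePoint u‖) ^ (γ * d) := by
          rw [mul_comm, Real.mul_rpow (by positivity) (norm_nonneg _)]
        _ ≤ _ := by gcongr
    have hT := isTransport_partner (d := d)
    have hT' := isTransport_localPartner (d := d) ρ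
    -- The separation is `‖v‖ + 2 * ρ ≤ 3 * ‖v‖ ≤ ‖w‖`.
    have hb := covSum_le_of_local hμ hA hAL (w := w) (ρ := ρ) (ε := ENNReal.ofReal (ε u))
      (abs_eventCov_localPartner_le_mixingCoeff hΨ hA hvol (s := ‖latticePoint v‖) (by linarith))
      (map_le_of_flower hΨ ((hT.and_not hT').measurableSet_hitEvent 0 MeasurableSet.univ) (by
        rintro φ ⟨x, -, hx, hx'⟩ hsub
        exact hx' ((partner_iff_localPartner_of_flower_subset hd hsub x).mp hx)))
      (map_le_of_flower hΨ ((hT'.and_not hT).measurableSet_hitEvent 0 MeasurableSet.univ) (by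
        rintro φ ⟨x, -, hx, hx'⟩ hsub
        exact hx' ((partner_iff_localPartner_of_flower_subset hd hsub x).mpr hx)))
    have hα0 := mixingCoeff_nonneg (P := P) (Ψ := Ψ) (‖latticePoint v‖ ^ (γ * d))
      ‖latticePoint v‖
    have hcardρ : ((latticeBall d (L + ρ)).card : ℝ) ≤
        L ^ d * (K * 2 ^ d * ‖latticePoint v‖ ^ (γ * d)) := by
      refine (hcard (L + ρ) (by linarith)).trans ?_
      calc K * (L + ρ) ^ d ≤ K * (L * 2 * ρ) ^ d := by gcongr; nlinarith
        _ = L ^ d * (K * 2 ^ d * ‖latticePoint u‖ ^ (γ * d)) := by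
          rw [mul_pow, mul_pow, hρd]; ring
        _ ≤ _ := by gcongr
    refine hb.trans ?_
    rw [← ENNReal.ofReal_natCast, ← ENNReal.ofReal_natCast,
      ← ENNReal.ofReal_mul (Nat.cast_nonneg _), ← ENNReal.ofReal_mul (Nat.cast_nonneg _),
      show (8 : ℝ≥0∞) = ENNReal.ofReal 8 by simp, ← ENNReal.ofReal_mul (by norm_num),
      ← ENNReal.ofReal_add (by positivity) (by have := hε0 u; positivity)]
    refine ENNReal.ofReal_le_ofReal ?_
    have e1 := mul_le_mul_of_nonneg_right hcardρ hα0
    have e2 := mul_le_mul_of_nonneg_right hcardd (hε0 u)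
    calc _ ≤ L ^ d * (K * 2 ^ d * ‖latticePoint v‖ ^ (γ * d)) *
          mixingCoeff Ψ P (‖latticePoint v‖ ^ (γ * d)) (‖latticePoint v‖ ^ (γ * d))
            ‖latticePoint v‖ + 8 * (L ^ d * (K * (1 + d) ^ d) * ε u) :=
          add_le_add e1 (by linarith)
      _ = _ := by rw [ha]; ring

end Domination

/-! ### Matched points counted by their lattice partners -/

section Counting

variable {d : ℕ}

/-- The matched points in a bounded set are counted by the lattice points that have a partner
there. -/
theorem hasSum_indicator_hitEvent {A : Set (Space d)} (hA : Bornology.IsBounded A)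
    (φ : Config d) :
    HasSum (fun p => (hitEvent Partner p A).indicator (fun _ => (1 : ℝ)) φ)
      (((matchedPoints (lattice d) φ).count A).toNat : ℝ) := by
  classical
  set S : Set (Fin d → ℤ) := {p | φ ∈ hitEvent Partner p A} with hS
  have hchoice : ∀ p, ∃ x, p ∈ S → x ∈ A ∧ Partner φ p x := fun p => by
    by_cases hp : p ∈ S
    · obtain ⟨x, hx⟩ := hp
      exact ⟨x, fun _ => hx⟩
    · exact ⟨0, fun h => absurd h hp⟩
  choose f hf using hchoice
  have hinj : Set.InjOn f S := fun p hp q hq hpq => by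
    have h1 := (hf p hp).2
    rw [hpq] at h1
    exact latticePoint_injective (Matched.fst_unique h1 (hf q hq).2)
  have himage : f '' S = (matchedPoints (lattice d) φ).carrier ∩ A := by
    ext x
    constructor
    · rintro ⟨p, hp, rfl⟩
      exact ⟨⟨Matched.snd_mem (hf p hp).2, _, (hf p hp).2⟩, (hf p hp).1⟩
    · rintro ⟨⟨-, q, hq⟩, hxA⟩
      obtain ⟨p, rfl⟩ := hq.fst_mem
      have hp : p ∈ S := ⟨x, hxA, hq⟩
      exact ⟨p, hp, Matched.snd_unique (hf p hp).2 hq⟩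
  have hfin : S.Finite := Set.Finite.of_finite_image
    (himage ▸ (matchedPoints (lattice d) φ).locallyFinite A hA) hinj
  have hcount : ((matchedPoints (lattice d) φ).count A).toNat = hfin.toFinset.card := by
    rw [Config.count, ← himage, hinj.encard_image, hfin.encard_eq_coe_toFinset_card, ENat.toNat_natCast]
  rw [hcount]
  have hsum : (hfin.toFinset.card : ℝ) =
      ∑ p ∈ hfin.toFinset, (hitEvent Partner p A).indicator (fun _ => (1 : ℝ)) φ := by
    rw [Finset.sum_congr rfl fun p hp => Set.indicator_of_mem
      (show φ ∈ hitEvent Partner p A from hfin.mem_toFinset.mp hp) _]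
    simp
  rw [hsum]
  exact hasSum_sum_of_ne_finset_zero fun p hp =>
    Set.indicator_of_notMem (fun h : φ ∈ hitEvent Partner p A => hp (hfin.mem_toFinset.mpr h)) _

end Counting

/-! ### Termwise limit and conclusion -/

section Hyperuniformity

variable {d : ℕ}

/-- After division by `r ^ d`, the boundary layer of fixed width becomes a shrinking neighbourhood
of `frontier W`, whose volume tends to that of the frontier, zero by convexity. What remains is at
most `C` times the probability of having no partner within `R`, small for suitable `R`. -/
theorem tendsto_covSum_smul_div {μ : Measure (Config d)} [IsProbabilityMeasure μ]
    (hμ : ∀ v : Fin d → ℤ, μ.map (fun φ => φ.shift (latticePoint v)) = μ)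
    (htight : ∀ ε > 0, ∃ R, μ.real (hitEvent Partner 0 (Metric.closedBall 0 R))ᶜ < ε)
    {W : Set (Space d)} (hconv : Convex ℝ W) (hcomp : IsCompact W) (w : Fin d → ℤ) :
    Tendsto (fun r : ℝ => (covSum μ (r • W) w).toReal / r ^ d) atTop (𝓝 0) := by
  obtain ⟨K, hK, hcard⟩ := exists_card_latticeBall_le d
  obtain ⟨L₀, hL₀, hWL⟩ := hcomp.isBounded.subset_closedBall_lt 1 0
  set C : ℝ := 2 * (K * (L₀ * (1 + d)) ^ d) with hC
  have hCpos : 0 < C := by positivity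
  have hfr : IsCompact (frontier W) := hcomp.of_isClosed_subset isClosed_frontier
    hcomp.isClosed.frontier_subset
  -- The absolute value appears because the radius supplied by `htight` is not known to be
  -- nonnegative.
  have hbound : ∀ R r : ℝ, 1 ≤ r → (covSum μ (r • W) w).toReal / r ^ d ≤
      (volume (Metric.cthickening ((d + |R|) / r) (frontier W))).toReal +
        C * μ.real (hitEvent Partner 0 (Metric.closedBall 0 R))ᶜ := by
    intro R r hr
    have hr0 : 0 < r := by linarith
    have hrL : 1 ≤ r * L₀ := by nlinarith
    have hsub : r • W ⊆ Metric.closedBall 0 (r * L₀) := by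
      refine (Set.smul_set_mono hWL).trans ?_
      rw [smul_closedBall _ _ (by linarith), smul_zero, Real.norm_of_nonneg hr0.le]
    have h1 := covSum_le_frontier hμ (hcomp.smul r).measurableSet hsub w (R := R)
    have h2 : volume (Metric.cthickening d (Metric.cthickening R (frontier (r • W)))) ≤
        ENNReal.ofReal (r ^ d) *
          volume (Metric.cthickening ((d + |R|) / r) (frontier W)) := by
      rw [frontier_smul_of_ne_zero hr0.ne']
      refine (measure_mono ?_).trans (volume_cthickening_smul_le hr0 _)
      refine (Metric.cthickening_subset_of_subset _
        (Metric.cthickening_mono (le_abs_self R) _)).trans ?_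
      exact Metric.cthickening_cthickening_subset (Nat.cast_nonneg d) (abs_nonneg R) _
    have h3 : ((latticeBall d (r * L₀ + d)).card : ℝ) ≤ r ^ d * (K * (L₀ * (1 + d)) ^ d) := by
      refine (hcard _ (by linarith [(Nat.cast_nonneg d : (0 : ℝ) ≤ d)])).trans ?_
      calc K * (r * L₀ + d) ^ d ≤ K * (r * (L₀ * (1 + d))) ^ d := by
            gcongr; nlinarith [(Nat.cast_nonneg d : (0 : ℝ) ≤ d)]
        _ = _ := by rw [mul_pow]; ring
    have hvol : volume (Metric.cthickening ((d + |R|) / r) (frontier W)) ≠ ∞ :=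
      hfr.isBounded.cthickening.measure_lt_top.ne
    have h4 : (covSum μ (r • W) w).toReal ≤
        r ^ d * (volume (Metric.cthickening ((d + |R|) / r) (frontier W))).toReal +
          2 * (((latticeBall d (r * L₀ + d)).card : ℝ) *
            μ.real (hitEvent Partner 0 (Metric.closedBall 0 R))ᶜ) := by
      refine (ENNReal.toReal_mono ?_ (h1.trans (add_le_add_left h2 _))).trans_eq ?_
      · exact ENNReal.add_ne_top.mpr ⟨ENNReal.mul_ne_top ENNReal.ofReal_ne_top hvol, by finiteness⟩
      · rw [ENNReal.toReal_add (ENNReal.mul_ne_top ENNReal.ofReal_ne_top hvol) (by finiteness)]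
        simp [measureReal_def, hr0.le]
    rw [div_le_iff₀ (by positivity)]
    refine h4.trans ?_
    have h5 := mul_le_mul_of_nonneg_right h3
      (measureReal_nonneg (μ := μ) (s := (hitEvent Partner 0 (Metric.closedBall 0 R))ᶜ))
    rw [hC]
    linarith
  have hvol0 : ∀ R : ℝ, Tendsto (fun r : ℝ =>
      (volume (Metric.cthickening ((d + |R|) / r) (frontier W))).toReal) atTop (𝓝 0) := by
    intro R
    have h1 := (tendsto_measure_cthickening_of_isCompact (μ := volume) hfr).comp
      (tendsto_const_nhds.div_atTop tendsto_id : Tendsto (fun r : ℝ => (d + |R|) / r) atTop (𝓝 0))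
    rw [hconv.addHaar_frontier volume] at h1
    exact (ENNReal.tendsto_toReal ENNReal.zero_ne_top).comp h1
  refine tendsto_order.mpr ⟨fun e he => ?_, fun e he => ?_⟩
  · filter_upwards [eventually_ge_atTop 0] with r hr
    exact he.trans_le (by positivity)
  · obtain ⟨R, hR⟩ := htight (e / 2 / C) (by positivity)
    filter_upwards [eventually_ge_atTop 1, (hvol0 R).eventually_lt_const (half_pos he)] with r hr hv
    refine (hbound R r hr).trans_lt ?_
    have := (lt_div_iff₀' hCpos).mp hR
    linarith

variable {Ω : Type*} [MeasurableSpace Ω] {P : Measure Ω} [IsProbabilityMeasure P]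
  {Ψ : Ω → Config d}

/-- The lattice is infinite for `1 ≤ d`, so a summable family on it has arbitrarily small terms; a
flower inside a ball puts the partner in that ball. -/
theorem exists_measureReal_compl_hitEvent_lt (hd : 1 ≤ d) (hΨ : Measurable Ψ) {γ : ℝ}
    (hflower : Summable (fun w : Fin d → ℤ =>
      P.real {ω | ¬ flower (lattice d) (Ψ ω) 0 ⊆
        Metric.closedBall 0 (‖latticePoint w‖ ^ γ)})) {ε : ℝ} (hε : 0 < ε) :
    ∃ R, (P.map Ψ).real (hitEvent Partner 0 (Metric.closedBall 0 R))ᶜ < ε := by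
  have : Nonempty (Fin d) := ⟨⟨0, hd⟩⟩
  obtain ⟨w, hw⟩ := (hflower.tendsto_cofinite_zero.eventually_lt_const hε).exists
  refine ⟨‖latticePoint w‖ ^ γ, lt_of_le_of_lt ?_ hw⟩
  refine ENNReal.toReal_le_of_le_ofReal measureReal_nonneg (map_le_of_flower hΨ
    (isTransport_partner.measurableSet_hitEvent 0 measurableSet_closedBall).compl ?_)
  intro φ hφ hsub
  obtain ⟨x, hx⟩ := exists_matched_of_flower_subset_closedBall hd hsub
  exact hφ ⟨x, hsub hx.mem_flower, by rwa [Partner, latticePoint_zero]⟩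

theorem tsum_eventCov_eq_tsum_covSum (μ : Measure (Config d)) (A : Set (Space d)) :
    ∑' p, ∑' q, ENNReal.ofReal |eventCov μ (hitEvent Partner p A) (hitEvent Partner q A)| =
      ∑' w, covSum μ A w := by
  simp only [covSum]
  rw [ENNReal.tsum_comm (α := Fin d → ℤ) (β := Fin d → ℤ)
    (f := fun w p => ENNReal.ofReal |eventCov μ (hitEvent Partner p A)
      (hitEvent Partner (p + w) A)|)]
  exact tsum_congr fun p => ((Equiv.addLeft p).tsum_eq fun q => ENNReal.ofReal
    |eventCov μ (hitEvent Partner p A) (hitEvent Partner q A)|).symm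

theorem isHyperuniform_matchedPoints (hd : 1 ≤ d) (hΨ : Measurable Ψ)
    (hstat : IsStationary Ψ P) {γ : ℝ} (hγ0 : 0 < γ) (hγ1 : γ ≤ 1)
    (hmix : Summable (fun w : Fin d → ℤ =>
      ‖latticePoint w‖ ^ (γ * d) *
        mixingCoeff Ψ P (‖latticePoint w‖ ^ (γ * d)) (‖latticePoint w‖ ^ (γ * d))
          ‖latticePoint w‖))
    (hflower : Summable (fun w : Fin d → ℤ =>
      P.real {ω | ¬ flower (lattice d) (Ψ ω) 0 ⊆
        Metric.closedBall 0 (‖latticePoint w‖ ^ γ)})) :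
    IsHyperuniform (fun ω => matchedPoints (lattice d) (Ψ ω)) P := by
  intro W hconv hcomp hpos
  have hprob : IsProbabilityMeasure (P.map Ψ) := Measure.isProbabilityMeasure_map hΨ.aemeasurable
  have hμ := hstat.map_shift hΨ
  obtain ⟨b, hb, hdom⟩ := exists_summable_bound_covSum hd hΨ hstat hγ0 hγ1 hmix hflower
  obtain ⟨L₀, hL₀, hWL⟩ := hcomp.isBounded.subset_closedBall_lt 1 0
  have hsub : ∀ r s : ℝ, 0 < r → r ≤ s → r • W ⊆ Metric.closedBall 0 (s * L₀) := by
    intro r s hr hrs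
    refine (Set.smul_set_mono hWL).trans ?_
    rw [smul_closedBall _ _ (by linarith), smul_zero, Real.norm_of_nonneg hr.le]
    exact Metric.closedBall_subset_closedBall (by gcongr)
  have hdom' : ∀ r s : ℝ, 0 < r → r ≤ s → 1 ≤ s → ∀ w,
      covSum (P.map Ψ) (r • W) w ≤ ENNReal.ofReal ((s * L₀) ^ d * b w) := fun r s hr hrs hs w =>
    hdom (s * L₀) (by nlinarith) _ (hcomp.smul r).measurableSet (hsub r s hr hrs) w
  -- The domination needs an enclosing radius at least 1, so small windows are treated with `max r
  -- 1`.
  have hfin : ∀ r : ℝ, 0 < r → ∑' w, covSum (P.map Ψ) (r • W) w ≠ ∞ := fun r hr =>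
    ((ENNReal.tsum_le_tsum (hdom' r (max r 1) hr (le_max_left _ _) (le_max_right _ _))).trans_lt
      (hb.mul_left _).tsum_ofReal_lt_top).ne
  have hvar : ∀ r : ℝ, 0 < r →
      MemLp (fun ω => (((matchedPoints (lattice d) (Ψ ω)).count (r • W)).toNat : ℝ)) 2 P ∧
      Var[fun ω => (((matchedPoints (lattice d) (Ψ ω)).count (r • W)).toNat : ℝ); P] ≤
        (∑' w, covSum (P.map Ψ) (r • W) w).toReal := by
    intro r hr
    have hbdd : Bornology.IsBounded (r • W) := (hcomp.smul r).isBounded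
    obtain ⟨hL, hV⟩ := memLp_and_variance_le_of_tsum_eventCov (μ := P.map Ψ)
      (fun p => isTransport_partner.measurableSet_hitEvent p (hcomp.smul r).measurableSet)
      (hasSum_indicator_hitEvent hbdd)
      (((tsum_measure_hitEvent_partner_le hμ (hsub r r hr le_rfl)).trans_lt
        (ENNReal.natCast_lt_top _)).ne) ENNReal.toReal_nonneg
      (by rw [tsum_eventCov_eq_tsum_covSum, ENNReal.ofReal_toReal (hfin r hr)])
    refine ⟨hL.comp_of_map hΨ.aemeasurable, ?_⟩
    rwa [variance_map hL.aestronglyMeasurable.aemeasurable hΨ.aemeasurable] at hV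
  refine ⟨fun r hr => (hvar r hr).1, ?_⟩
  have hlim : Tendsto (fun r : ℝ => ∑' w, (covSum (P.map Ψ) (r • W) w).toReal / r ^ d) atTop
      (𝓝 0) := by
    rw [← tsum_zero (α := ℝ) (β := Fin d → ℤ)]
    -- The factor `(r * L₀) ^ d` in the domination cancels `r ^ d`, leaving a summable majorant
    -- independent of `r`.
    refine tendsto_tsum_of_dominated_convergence (hb.abs.mul_left (L₀ ^ d))
      (fun w => tendsto_covSum_smul_div hμ
        (fun ε hε => exists_measureReal_compl_hitEvent_lt hd hΨ hflower hε) hconv hcomp w) ?_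
    filter_upwards [eventually_ge_atTop 1] with r hr w
    have hr0 : 0 < r := by linarith
    rw [Real.norm_of_nonneg (by positivity), div_le_iff₀ (by positivity)]
    refine ENNReal.toReal_le_of_le_ofReal (by positivity)
      ((hdom' r r hr0 le_rfl hr w).trans (ENNReal.ofReal_le_ofReal ?_))
    calc (r * L₀) ^ d * b w ≤ (r * L₀) ^ d * |b w| := by gcongr; exact le_abs_self _
      _ = _ := by rw [mul_pow]; ring
  have hlim' := hlim.div_const (volume W).toReal
  rw [zero_div] at hlim'
  refine tendsto_of_tendsto_of_tendsto_of_le_of_le' tendsto_const_nhds hlim' ?_ ?_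
  · exact Eventually.of_forall fun r => div_nonneg (variance_nonneg _ _) ENNReal.toReal_nonneg
  · filter_upwards [eventually_gt_atTop 0] with r hr
    have hne : ∀ w, covSum (P.map Ψ) (r • W) w ≠ ∞ := ENNReal.ne_top_of_tsum_ne_top (hfin r hr)
    rw [volume_smul hr.le, ENNReal.toReal_mul, ENNReal.toReal_ofReal (by positivity),
      tsum_div_const, ← ENNReal.tsum_toReal_eq hne, div_div]
    gcongr
    exact (hvar r hr).2

end Hyperuniformity

end StableMatching
theorem theorem6p1 {d : ℕ} (hd : 1 ≤ d)
    {Ω : Type*} [MeasurableSpace Ω] (P : Measure Ω) [IsProbabilityMeasure P]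
    (Ψ : Ω → Config d) (hΨ : Measurable Ψ) (hstat : IsStationary Ψ P)
    (α : ℝ) (hα : 1 ≤ α) (hint : intensity Ψ P = ENNReal.ofReal α)
    (γ : ℝ) (hγ0 : 0 < γ) (hγ1 : γ ≤ 1)
    (hmix : Summable (fun w : Fin d → ℤ =>
      ‖latticePoint w‖ ^ (γ * d) *
        mixingCoeff Ψ P (‖latticePoint w‖ ^ (γ * d)) (‖latticePoint w‖ ^ (γ * d))
          ‖latticePoint w‖))
    (hflower : Summable (fun w : Fin d → ℤ =>
      P.real {ω | ¬ flower (lattice d) (Ψ ω) 0 ⊆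
        Metric.closedBall 0 (‖latticePoint w‖ ^ γ)})) :
    IsHyperuniform (fun ω => matchedPoints (lattice d) (Ψ ω)) P :=
  isHyperuniform_matchedPoints hd hΨ hstat hγ0 hγ1 hmix hflower
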